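/- Let $G$ be a simply connected, finite-dimensional, complex semi-simple Lie group with Lie algebra $\mathfrak g$, and let $H\subset G$ be a connected compact real form of $G$, with Lie algebra $\mathfrak h$; thus $\mathfrak g=\mathfrak h\oplus\mathfrak m$ with $\mathfrak m=i\mathfrak h$. Fix $\lambda>0$ and set $B(X,Y)=\lambda\,\mathrm{tr}(ad(X)\circ ad(Y))$ on $\mathfrak g$. Let $Cl(\mathfrak g)$ be the complex Clifford algebra with $u\cdot v+v\cdot u=-2B(u,v)$, and $$Spin(\mathfrak g)=\{u_1\cdots u_{2k}:\ u_i\in\mathfrak g,\ B(u_i,u_i)=1\}\subset Cl(\mathfrak g).$$ A $B$-skew-symmetric endomorphism $u$ of $\mathfrak g$ is identified with the element $\tfrac12\sum_j e_j\cdot u(e_j)$ of $\Lambda^2\mathfrak g\subset Cl(\mathfrak g)$, where $(e_j)$ is any $B$-orthonormal complex basis of $\mathfrak g$. Then there is a unique continuous group morphism $\widetilde{Ad}:G\to Spin(\mathfrak g)$ lifting the adjoint representation, i.e. with $\widetilde{Ad}(g)\cdot v\cdot\widetilde{Ad}(g)^{-1}=Ad(g)(v)$ for all $g\in G$, $v\in\mathfrak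 g$. For $h\in H$ let $\rho(h)$ be the left multiplication by $\widetilde{Ad}(h)$ on $Cl(\mathfrak g)$, and set $\Sigma=G\times_\rho Cl(\mathfrak g)$, $U\Sigma=G\times_\rho\widetilde{Ad}(G)\subset\Sigma$, $Cl_\Sigma=G\times_{Ad_{|H}}Cl(\mathfrak g)$ and $T(G/H)=G\times_{Ad_{|H}}\mathfrak m$, which are bundles over $G/H$; $Cl_\Sigma$ acts on $\Sigma$ by $[g,\eta]\cdot[g,v]=[g,\eta\cdot v]$, and $ad:T(G/H)\to Cl_\Sigma$ is the map $[g,u]\mapsto[g,ad(u)]$. Let $\alpha=p_{\mathfrak h}\circ\omega_G$ be the canonical connection form on $G\to G/H$, where $\omega_G$ is the Maurer-Cartan form of $G$ and $p_{\mathfrak h}:\mathfrak g\to\mathfrak h$ is the projection along $\mathfrak m$, and let $\nabla^o$ be the connection on $\Sigma$ associated with $\alpha$: if $\varphi=[s,f]$ along a curve $s$ in $G$ whose projection to $G/H$ is tangent to $X$ at the parameter $0$, then $\nabla^o_X\varphi=[s(0),f'(0)+\rho_*(\alpha(s'(0)))f(0)]$. The formula $$\varphi(gH)=[g,\widetilde{Ad}(g^{-1})]$$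 gives a well-defined smooth global section $\varphi$ of $U\Sigma$ over $G/H$, and $$\nabla^o_X\varphi=-\tfrac12\,ad(X)\cdot\varphi\qquad\text{for all }X\in T(G/H).$$ -/

import Mathlib

open scoped Manifold ContDiff

noncomputable section

namespace SymSpin

/-! ### The complex Lie group and its adjoint representation -/

section LieGroup

instance completeOfFiniteDim (E : Type*) [NormedAddCommGroup E] [NormedSpace ℂ E]
    [FiniteDimensional ℂ E] : CompleteSpace E := FiniteDimensional.complete ℂ E

variable (E : Type*) [NormedAddCommGroup E] [NormedSpace ℂ E]
  (G : Type*) [TopologicalSpace G] [ChartedSpace E G] [Group G]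

/-- The Lie algebra `𝔤 = T_e G` of the complex Lie group `G`, a complex vector space. -/
abbrev LieAlg : Type _ := GroupLieAlgebra 𝓘(ℂ, E) G

instance [FiniteDimensional ℂ E] : FiniteDimensional ℂ (LieAlg E G) :=
  inferInstanceAs (FiniteDimensional ℂ E)

variable {G}

/-- The differential at `e` of the conjugation `x ↦ g x g⁻¹`. -/
def conjDeriv (g : G) : LieAlg E G →L[ℂ] LieAlg E G :=
  mfderiv 𝓘(ℂ, E) 𝓘(ℂ, E) (fun x : G => g * x * g⁻¹) 1

/-- The Maurer-Cartan form `ω_G`: at `g`, the differential of `x ↦ g⁻¹ x`. -/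
def maurerCartan (g : G) : TangentSpace 𝓘(ℂ, E) g →L[ℂ] LieAlg E G :=
  mfderiv 𝓘(ℂ, E) 𝓘(ℂ, E) (fun x : G => g⁻¹ * x) g

theorem conjDeriv_one : conjDeriv E (1 : G) = ContinuousLinearMap.id ℂ (LieAlg E G) := by
  have : (fun x : G => (1 : G) * x * (1 : G)⁻¹) = id := by ext x; simp
  unfold conjDeriv
  rw [this]
  exact mfderiv_id

variable [LieGroup 𝓘(ℂ, E) ω G]

theorem contMDiff_conj (g : G) :
    ContMDiff 𝓘(ℂ, E) 𝓘(ℂ, E) ω (fun x : G => g * x * g⁻¹) :=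
  (contMDiff_mul_right (I := 𝓘(ℂ, E)) (n := ω) (a := g⁻¹)).comp
    (contMDiff_mul_left (I := 𝓘(ℂ, E)) (n := ω) (a := g))

theorem mdiff_conj (g x : G) :
    MDifferentiableAt 𝓘(ℂ, E) 𝓘(ℂ, E) (fun x : G => g * x * g⁻¹) x :=
  (contMDiff_conj E g).mdifferentiable (by simp) x

theorem mdiff_mul_left (g x : G) :
    MDifferentiableAt 𝓘(ℂ, E) 𝓘(ℂ, E) (fun x : G => g * x) x :=
  (contMDiff_mul_left (I := 𝓘(ℂ, E)) (n := ω) (a := g)).mdifferentiable (by simp) x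

theorem conjDeriv_mul (g h : G) : conjDeriv E (g * h) = (conjDeriv E g).comp (conjDeriv E h) := by
  have h1 : (fun x : G => g * h * x * (g * h)⁻¹)
      = (fun x : G => g * x * g⁻¹) ∘ (fun x : G => h * x * h⁻¹) := by
    ext x; simp [mul_assoc]
  have h2 : h * 1 * h⁻¹ = 1 := by simp
  unfold conjDeriv
  rw [h1, mfderiv_comp (I' := 𝓘(ℂ, E)) _ (mdiff_conj E g _) (mdiff_conj E h _)]
  congr 2 

variable (G) in
/-- The adjoint representation `Ad : G → GL(𝔤)`. -/
def Ad : Representation ℂ G (LieAlg E G) where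
  toFun g := (conjDeriv E g).toLinearMap
  map_one' := by rw [conjDeriv_one]; rfl
  map_mul' g h := by rw [conjDeriv_mul]; rfl


theorem Ad_apply (g : G) (v : LieAlg E G) : Ad E G g v = conjDeriv E g v := rfl

theorem mulInvariantVectorField_conj (g x : G) (v : LieAlg E G) :
    (mulInvariantVectorField (Ad E G g v) (g * x * g⁻¹) : E)
      = mfderiv 𝓘(ℂ, E) 𝓘(ℂ, E) (fun x : G => g * x * g⁻¹) x (mulInvariantVectorField v x) := by
  have h1 : (fun y : G => g * x * g⁻¹ * y) ∘ (fun x : G => g * x * g⁻¹)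
      = (fun x : G => g * x * g⁻¹) ∘ (fun y : G => x * y) := by
    ext y; simp [mul_assoc]
  have h2 := mfderiv_comp (I := 𝓘(ℂ, E)) (I' := 𝓘(ℂ, E)) (I'' := 𝓘(ℂ, E)) (1 : G)
    (mdiff_mul_left E (g * x * g⁻¹) _) (mdiff_conj E g 1)
  have h3 := mfderiv_comp (I := 𝓘(ℂ, E)) (I' := 𝓘(ℂ, E)) (I'' := 𝓘(ℂ, E)) (1 : G)
    (mdiff_conj E g _) (mdiff_mul_left E x 1)
  rw [h1, h3] at h2
  have h4 := congrArg (fun T : E →L[ℂ] E => T v) h2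
  have e1 : g * 1 * g⁻¹ = 1 := by simp
  have e2 : x * 1 = x := by simp
  rw [e1, e2] at h4
  exact h4.symm

theorem conj_invertible (g x : G) :
    (mfderiv 𝓘(ℂ, E) 𝓘(ℂ, E) (fun x : G => g * x * g⁻¹) x).IsInvertible := by
  have key : ∀ g k x : G, k * g = 1 → (mfderiv 𝓘(ℂ, E) 𝓘(ℂ, E) (fun x : G => k * x * k⁻¹)
      (g * x * g⁻¹)).comp (mfderiv 𝓘(ℂ, E) 𝓘(ℂ, E) (fun x : G => g * x * g⁻¹) x)
        = ContinuousLinearMap.id ℂ E := by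
    intro g k x h
    obtain rfl : k = g⁻¹ := eq_inv_of_mul_eq_one_left h
    rw [← mfderiv_comp (I' := 𝓘(ℂ, E)) _ (mdiff_conj E g⁻¹ _) (mdiff_conj E g x)]
    have : (fun x : G => g⁻¹ * x * (g⁻¹)⁻¹) ∘ (fun x : G => g * x * g⁻¹) = id := by
      ext y; simp [mul_assoc]
    rw [this]
    exact mfderiv_id
  have k2 := key g⁻¹ g (g * x * g⁻¹) (by simp)
  have e : g⁻¹ * (g * x * g⁻¹) * (g⁻¹)⁻¹ = x := by simp [mul_assoc]
  rw [e] at k2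
  exact ContinuousLinearMap.IsInvertible.of_inverse k2 (key g g⁻¹ x (by simp))

variable [FiniteDimensional ℂ E]

theorem Ad_lie (g : G) (v w : LieAlg E G) : Ad E G g ⁅v, w⁆ = ⁅Ad E G g v, Ad E G g w⁆ := by
  have pull : ∀ v : LieAlg E G, VectorField.mpullback 𝓘(ℂ, E) 𝓘(ℂ, E) (fun x : G => g * x * g⁻¹)
      (mulInvariantVectorField (Ad E G g v)) = mulInvariantVectorField v := by
    intro v
    ext x
    obtain ⟨e, he⟩ := conj_invertible E g x
    have := mulInvariantVectorField_conj E g x v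
    rw [VectorField.mpullback, ← he, ContinuousLinearMap.inverse_equiv]
    rw [← he] at this
    exact (e.symm_apply_eq).2 this
  obtain ⟨u, hu⟩ : ∃ u, ⁅Ad E G g v, Ad E G g w⁆ = Ad E G g u := by
    refine ⟨Ad E G g⁻¹ ⁅Ad E G g v, Ad E G g w⁆, ?_⟩
    rw [← Module.End.mul_apply, ← map_mul]; simp
  have h := VectorField.mpullback_mlieBracket (I := 𝓘(ℂ, E)) (I' := 𝓘(ℂ, E)) (n := ω)
    (f := fun x : G => g * x * g⁻¹) (V := mulInvariantVectorField (Ad E G g v))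
    (W := mulInvariantVectorField (Ad E G g w)) (x₀ := 1)
    (mdifferentiableAt_mulInvariantVectorField _) (mdifferentiableAt_mulInvariantVectorField _)
    (contMDiff_conj E g).contMDiffAt le_top
  rw [← mulInvariantVector_mlieBracket, ← GroupLieAlgebra.bracket_def, hu, pull, pull, pull,
    ← GroupLieAlgebra.bracket_def] at h
  rw [hu, ← h]
  congr 1
  have : (fun x : G => 1 * x) = id := by ext; simp
  rw [mulInvariantVectorField, this, mfderiv_id]
  rfl

end LieGroup

/-! ### The form `B`, the complex Clifford algebra and the spin group of `𝔤` -/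

section Clifford

variable (E : Type*) [NormedAddCommGroup E] [NormedSpace ℂ E] [FiniteDimensional ℂ E]
  (G : Type*) [TopologicalSpace G] [ChartedSpace E G] [Group G] [LieGroup 𝓘(ℂ, E) ω G]

/-- The form `B(X, Y) = lam * tr (ad X ∘ ad Y)` on `𝔤`, for `lam > 0`. -/
def formB (lam : Set.Ioi (0 : ℝ)) : LinearMap.BilinForm ℂ (LieAlg E G) :=
  (((lam : ℝ) : ℂ)) • killingForm ℂ (LieAlg E G)

/-- The quadratic form `u ↦ - B(u, u)`, so that `u * v + v * u = - 2 B(u, v)` in its Clifford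
algebra. -/
def cliffForm (lam : Set.Ioi (0 : ℝ)) : QuadraticForm ℂ (LieAlg E G) :=
  -(formB E G lam).toQuadraticMap

/-- The complex Clifford algebra `Cl(𝔤)`. -/
abbrev Cl (lam : Set.Ioi (0 : ℝ)) : Type _ := CliffordAlgebra (cliffForm E G lam)

/-- The natural inclusion `𝔤 → Cl(𝔤)`. -/
abbrev vec (lam : Set.Ioi (0 : ℝ)) : LieAlg E G →ₗ[ℂ] Cl E G lam :=
  CliffordAlgebra.ι (cliffForm E G lam)

theorem vec_mul_add (lam : Set.Ioi (0 : ℝ)) (u v : LieAlg E G) :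
    vec E G lam u * vec E G lam v + vec E G lam v * vec E G lam u
      = algebraMap ℂ _ (-2 * formB E G lam u v) := by
  rw [CliffordAlgebra.ι_mul_ι_add_swap]
  congr 1
  have : formB E G lam v u = formB E G lam u v := by
    simp only [formB, LinearMap.smul_apply]
    rw [LieModule.traceForm_comm]
  simp [cliffForm, QuadraticMap.polar, this]
  ring

/-- `Spin(𝔤)`: the products of an even number of vectors `u` of `𝔤` with `B(u, u) = 1`. -/
def spin (lam : Set.Ioi (0 : ℝ)) : Set (Cl E G lam) :=
  {x | ∃ l : List (LieAlg E G), Even l.length ∧ (∀ u ∈ l, formB E G lam u u = 1) ∧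
    x = (l.map (vec E G lam)).prod}

theorem exteriorAlgebra_finite (V : Type*) [AddCommGroup V] [Module ℂ V] [FiniteDimensional ℂ V] :
    FiniteDimensional ℂ (ExteriorAlgebra ℂ V) := by
  have hbot : ∀ n, Module.finrank ℂ V < n → (⋀[ℂ]^n V) = ⊥ := by
    intro n hn
    have := exteriorPower.finrank_eq ℂ n (M := V)
    rw [Nat.choose_eq_zero_of_lt hn] at this
    exact Submodule.finrank_eq_zero.1 this
  have htop : (⨆ n : Fin (Module.finrank ℂ V + 1), ⋀[ℂ]^(n : ℕ) V) = ⊤ := by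
    rw [eq_top_iff, ← (DirectSum.Decomposition.isInternal
      (fun n : ℕ => ⋀[ℂ]^n V)).submodule_iSup_eq_top]
    refine iSup_le fun n => ?_
    by_cases h : Module.finrank ℂ V < n
    · rw [hbot n h]; exact bot_le
    · exact le_iSup (fun n : Fin (Module.finrank ℂ V + 1) => ⋀[ℂ]^(n : ℕ) V)
        ⟨n, by omega⟩
  have : FiniteDimensional ℂ (⊤ : Submodule ℂ (ExteriorAlgebra ℂ V)) := by
    rw [← htop]; infer_instance
  exact Module.Finite.equiv (Submodule.topEquiv (R := ℂ) (M := ExteriorAlgebra ℂ V))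

instance (lam : Set.Ioi (0 : ℝ)) : FiniteDimensional ℂ (Cl E G lam) := by
  have := exteriorAlgebra_finite (LieAlg E G)
  exact Module.Finite.equiv (CliffordAlgebra.equivExterior (cliffForm E G lam)).symm

/-- A norm on the finite-dimensional complex vector space `Cl(𝔤)`, the supremum norm in a basis.
All norms on it are equivalent; the norm only serves to give `Cl(𝔤)` its usual topology and smooth
structure. -/
instance (lam : Set.Ioi (0 : ℝ)) : NormedAddCommGroup (Cl E G lam) :=
  NormedAddCommGroup.induced (Cl E G lam) (Fin (Module.finrank ℂ (Cl E G lam)) → ℂ)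
    (Module.finBasis ℂ (Cl E G lam)).equivFun.toLinearMap
    (Module.finBasis ℂ (Cl E G lam)).equivFun.injective

instance (lam : Set.Ioi (0 : ℝ)) : NormedSpace ℂ (Cl E G lam) :=
  NormedSpace.induced ℂ (Cl E G lam) (Fin (Module.finrank ℂ (Cl E G lam)) → ℂ)
    (Module.finBasis ℂ (Cl E G lam)).equivFun.toLinearMap

theorem formB_Ad (lam : Set.Ioi (0 : ℝ)) (g : G) (u v : LieAlg E G) :
    formB E G lam (Ad E G g u) (Ad E G g v) = formB E G lam u v := by
  let e : LieAlg E G ≃ₗ⁅ℂ⁆ LieAlg E G :=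
    { (Ad E G g : LieAlg E G →ₗ[ℂ] LieAlg E G) with
      map_lie' := fun {v w} => Ad_lie E g v w
      invFun := Ad E G g⁻¹
      left_inv := fun v => by
        change (Ad E G g⁻¹) (Ad E G g v) = v
        rw [← Module.End.mul_apply, ← map_mul]; simp
      right_inv := fun v => by
        change (Ad E G g) (Ad E G g⁻¹ v) = v
        rw [← Module.End.mul_apply, ← map_mul]; simp }
  have := LieAlgebra.killingForm_of_equiv_apply e u v
  simp only [formB, LinearMap.smul_apply]
  exact congrArg _ this

/-- `e` is a complex basis of `𝔤` with `B(e_i, e_j) = δ_ij`. -/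
def IsOrthonormalBasis (lam : Set.Ioi (0 : ℝ))
    (e : Module.Basis (Fin (Module.finrank ℂ (LieAlg E G))) ℂ (LieAlg E G)) : Prop :=
  ∀ i j, formB E G lam (e i) (e j) = if i = j then 1 else 0

variable [LieAlgebra.IsSemisimple ℂ (LieAlg E G)]

theorem exists_isOrthonormalBasis (lam : Set.Ioi (0 : ℝ)) :
    ∃ e, IsOrthonormalBasis E G lam e := by
  have hnd : (formB E G lam).Nondegenerate := by
    have := LieAlgebra.IsKilling.killingForm_nondegenerate ℂ (LieAlg E G)
    have h0 : ((lam : ℝ) : ℂ) ≠ 0 := by exact_mod_cast lam.2.ne'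
    refine ⟨fun x hx => this.1 x fun y => ?_, fun x hx => this.2 x fun y => ?_⟩
    · have := hx y
      simpa [formB, h0] using this
    · have := hx y
      simpa [formB, h0] using this
  have hs : LinearMap.IsSymm (formB E G lam) := by
    constructor
    intro u v
    simp only [formB, LinearMap.smul_apply, RingHom.id_apply]
    rw [LieModule.traceForm_comm]
  obtain ⟨v, hv⟩ := LinearMap.BilinForm.exists_orthogonal_basis hs
  have hne : ∀ i, formB E G lam (v i) (v i) ≠ 0 := fun i =>
    LinearMap.IsOrthoᵢ.not_isOrtho_basis_self_of_separatingLeft hv hnd.1 i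
  choose c hc using fun i => IsAlgClosed.exists_pow_nat_eq (formB E G lam (v i) (v i)) (n := 2)
    (by norm_num)
  have hc0 : ∀ i, c i ≠ 0 := fun i h => hne i (by rw [← hc i, h]; simp)
  refine ⟨v.unitsSMul fun i => (Units.mk0 (c i) (hc0 i))⁻¹, fun i j => ?_⟩
  simp only [Module.Basis.unitsSMul_apply, Units.smul_def, map_smul, LinearMap.smul_apply]
  split_ifs with h
  · subst h
    rw [← hc i]
    have := hc0 i
    simp; field_simp
  · have : formB E G lam (v i) (v j) = 0 := hv h
    simp [this]

/-- An orthonormal basis of `(𝔤, B)`. -/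
def onb (lam : Set.Ioi (0 : ℝ)) :
    Module.Basis (Fin (Module.finrank ℂ (LieAlg E G))) ℂ (LieAlg E G) :=
  (exists_isOrthonormalBasis E G lam).choose

theorem onb_spec (lam : Set.Ioi (0 : ℝ)) : IsOrthonormalBasis E G lam (onb E G lam) :=
  (exists_isOrthonormalBasis E G lam).choose_spec

/-- The element of `Λ²𝔤 ⊂ Cl(𝔤)` which represents an endomorphism `u` of `𝔤` that is
skew-symmetric with respect to `B`: it is `1/2 ∑ e_j · u(e_j)` for any orthonormal basis `(e_j)`,
so that `e_i · e_j`, for `i ≠ j`, represents the map `e_i ↦ e_j, e_j ↦ - e_i`, with the other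
vectors of the basis mapped to `0`. -/
def bivector (lam : Set.Ioi (0 : ℝ)) (u : Module.End ℂ (LieAlg E G)) : Cl E G lam :=
  (1 / 2 : ℂ) • ∑ j, vec E G lam (onb E G lam j) * vec E G lam (u (onb E G lam j))

theorem bivector_eq (lam : Set.Ioi (0 : ℝ)) (u : Module.End ℂ (LieAlg E G))
    (f : Module.Basis (Fin (Module.finrank ℂ (LieAlg E G))) ℂ (LieAlg E G))
    (hf : IsOrthonormalBasis E G lam f) :
    bivector E G lam u = (1 / 2 : ℂ) • ∑ j, vec E G lam (f j) * vec E G lam (u (f j)) := by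
  have ex : ∀ (f : Module.Basis (Fin (Module.finrank ℂ (LieAlg E G))) ℂ (LieAlg E G)),
      IsOrthonormalBasis E G lam f → ∀ x, x = ∑ i, formB E G lam x (f i) • f i := by
    intro f hf x
    have h : ∀ i, formB E G lam x (f i) = f.repr x i := by
      intro i
      conv_lhs => rw [← f.sum_repr x]
      simp only [map_sum, map_smul, LinearMap.sum_apply, LinearMap.smul_apply, hf _ i]
      simp
    simp only [h, f.sum_repr]
  have hs : ∀ u v, formB E G lam u v = formB E G lam v u := by
    intro u v
    simp only [formB, LinearMap.smul_apply]
    rw [LieModule.traceForm_comm]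
  set e := onb E G lam with he
  have hee := onb_spec E G lam
  rw [← he] at hee
  unfold bivector
  rw [← he]
  congr 1
  have e1 : ∀ j, vec E G lam (f j) * vec E G lam (u (f j)) = ∑ i, ∑ k,
      (formB E G lam (e i) (f j) * formB E G lam (e k) (f j)) •
        (vec E G lam (e i) * vec E G lam (u (e k))) := by
    intro j
    conv_lhs => rw [ex e hee (f j)]
    simp only [map_sum, map_smul, Finset.sum_mul_sum, smul_mul_smul_comm, hs (f j)]
  simp only [e1]
  rw [Finset.sum_comm]
  refine Finset.sum_congr rfl fun i _ => ?_
  rw [Finset.sum_comm]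
  have e2 : ∀ k, ∑ j, formB E G lam (e i) (f j) * formB E G lam (e k) (f j)
      = if i = k then 1 else 0 := by
    intro k
    rw [← hee i k]
    conv_rhs => rw [ex f hf (e k)]
    simp only [map_sum, map_smul, smul_eq_mul]
    exact Finset.sum_congr rfl fun j _ => mul_comm _ _
  simp only [← Finset.sum_smul, e2]
  simp

end Clifford

/-! ### Homogeneous bundles over `G / H` -/

section AssocBundle

variable {k G V : Type*} [Field k] [Group G] [AddCommGroup V] [Module k V]
  {H : Subgroup G} (ρ : Representation k H V)

/-- The relation `(g, v) ∼ (g h, ρ(h)⁻¹ v)`, `h ∈ H`, on `G × V`. -/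
def assocSetoid : Setoid (G × V) where
  r p q := ∃ h : H, q = (p.1 * h, ρ h⁻¹ p.2)
  iseqv :=
    { refl := fun p => ⟨1, by simp⟩
      symm := by
        rintro ⟨g, v⟩ _ ⟨h, rfl⟩
        refine ⟨h⁻¹, ?_⟩
        simp [← Module.End.mul_apply, ← map_mul]
      trans := by
        rintro ⟨g, v⟩ _ _ ⟨h, rfl⟩ ⟨h', rfl⟩
        refine ⟨h * h', ?_⟩
        simp [mul_assoc] }

/-- The total space `G ×_ρ V` of the bundle over `G / H` associated with `ρ`. -/
def AssocBundle : Type _ := Quotient (assocSetoid ρ)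

namespace AssocBundle

/-- The class `[g, v]` in `G ×_ρ V`. -/
def mk (g : G) (v : V) : AssocBundle ρ := Quotient.mk (assocSetoid ρ) (g, v)

/-- The projection `G ×_ρ V → G / H`, `[g, v] ↦ g H`. -/
def proj : AssocBundle ρ → G ⧸ H :=
  Quotient.lift (fun p : G × V => (p.1 : G ⧸ H)) (by
    rintro ⟨g, v⟩ _ ⟨h, rfl⟩
    simp)

/-- Multiplication by scalars in the fibres, `c [g, v] = [g, c v]`. -/
instance : SMul k (AssocBundle ρ) where
  smul c := Quotient.map' (s₁ := assocSetoid ρ) (s₂ := assocSetoid ρ)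
    (fun p : G × V => (p.1, c • p.2)) (by
      rintro ⟨g, v⟩ _ ⟨h, rfl⟩
      exact ⟨h, by simp⟩)

end AssocBundle

end AssocBundle

/-! ### The compact real form `H` and the tangent bundle of `G / H` -/

section RealForm

theorem hasMFDerivAt_real (E : Type*) [NormedAddCommGroup E] [NormedSpace ℂ E]
    {G : Type*} [TopologicalSpace G] [ChartedSpace E G] {f : G → G} {x : G} {f' : E →L[ℂ] E}
    (h : HasMFDerivAt 𝓘(ℂ, E) 𝓘(ℂ, E) f x f') :
    HasMFDerivAt 𝓘(ℝ, E) 𝓘(ℝ, E) f x (f'.restrictScalars ℝ) :=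
  ⟨h.1, HasFDerivWithinAt.restrictScalars ℝ h.2⟩

variable (E : Type*) [NormedAddCommGroup E] [NormedSpace ℂ E]
  {G : Type*} [TopologicalSpace G] [ChartedSpace E G] [Group G]

/-- `γ` is differentiable at `t`, as a curve in the real manifold underlying `G`, with velocity
`ξ`. -/
def HasVelocityAt (γ : ℝ → G) (t : ℝ) (ξ : TangentSpace 𝓘(ℂ, E) (γ t)) : Prop :=
  HasMFDerivAt 𝓘(ℝ, ℝ) 𝓘(ℝ, E) γ t ((1 : ℝ →L[ℝ] ℝ).smulRight (show E from ξ))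

/-- The velocities at `e` of the one-parameter subgroups of `G` with values in `H`. -/
def oneParamVelocities (H : Subgroup G) : Set (LieAlg E G) :=
  {X | ∃ c : ℝ → G, (∀ s t, c (s + t) = c s * c t) ∧ (∀ t, c t ∈ H) ∧ HasVelocityAt E c 0 X}

/-- The Lie algebra `𝔥 ⊂ 𝔤` of a closed subgroup `H` of `G`, as a real vector space. (If `H` is
closed, the set of velocities of its one-parameter subgroups is already a linear subspace.) -/
def lieH (H : Subgroup G) : Submodule ℝ (LieAlg E G) :=
  Submodule.span ℝ (oneParamVelocities E H)

/-- The subspace `𝔪 = i 𝔥` of `𝔤`. -/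
def lieM (H : Subgroup G) : Submodule ℝ (LieAlg E G) :=
  (lieH E H).map ((Complex.I • (LinearMap.id : LieAlg E G →ₗ[ℂ] LieAlg E G)).restrictScalars ℝ)

/-- `H` is a compact real form of `G`: it is compact and `𝔤 = 𝔥 ⊕ i 𝔥`. -/
structure IsCompactRealForm (H : Subgroup G) : Prop where
  isCompact : IsCompact (H : Set G)
  isCompl : IsCompl (lieH E H) (lieM E H)

variable [LieGroup 𝓘(ℂ, E) ω G]

theorem Ad_mem_lieH (H : Subgroup G) (h : H) {X : LieAlg E G} (hX : X ∈ lieH E H) :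
    Ad E G h X ∈ lieH E H := by
  have : lieH E H ≤ (lieH E H).comap ((Ad E G h).restrictScalars ℝ) := by
    refine Submodule.span_le.2 ?_
    rintro X ⟨c, hc, hcH, hv⟩
    refine Submodule.subset_span ⟨fun t => h * c t * (h : G)⁻¹, fun s t => ?_, fun t => ?_, ?_⟩
    · simp [hc, mul_assoc]
    · exact H.mul_mem (H.mul_mem h.2 (hcH t)) (H.inv_mem h.2)
    · have hc0 : c 0 = 1 := by
        have := hc 0 0
        simpa using this
      have h1 := (hasMFDerivAt_real E (mdiff_conj E (h : G) (c 0)).hasMFDerivAt).comp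
        (I := 𝓘(ℝ, ℝ)) (0 : ℝ) hv
      have h2 : ∀ x : G, x = 1 →
          (mfderiv 𝓘(ℂ, E) 𝓘(ℂ, E) (fun y : G => (h : G) * y * (h : G)⁻¹) x : E →L[ℂ] E) X
            = Ad E G h X := by
        rintro _ rfl
        rfl
      refine HasMFDerivAt.congr_mfderiv h1 ?_
      refine ContinuousLinearMap.ext_ring ?_
      have e1 : ((1 : ℝ →L[ℝ] ℝ).smulRight (show E from X)) 1 = X := by
        rw [ContinuousLinearMap.smulRight_apply]
        exact one_smul ℝ (show E from X)
      have e2 : ((1 : ℝ →L[ℝ] ℝ).smulRight (show E from Ad E G h X)) 1 = Ad E G h X := by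
        rw [ContinuousLinearMap.smulRight_apply]
        exact one_smul ℝ (show E from Ad E G h X)
      refine Eq.trans ?_ ((h2 _ hc0).trans e2.symm)
      exact congrArg (mfderiv 𝓘(ℂ, E) 𝓘(ℂ, E) (fun y : G => (h : G) * y * (h : G)⁻¹) (c 0) :
        E →L[ℂ] E) e1
  exact this hX

theorem Ad_mem_lieM (H : Subgroup G) (h : H) {X : LieAlg E G} (hX : X ∈ lieM E H) :
    Ad E G h X ∈ lieM E H := by
  obtain ⟨Y, hY, rfl⟩ := hX
  refine ⟨Ad E G h Y, Ad_mem_lieH E H h hY, ?_⟩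
  simp

/-- The isotropy representation `Ad_{|H}` of `H` on `𝔪`. -/
def isotropyRep (H : Subgroup G) : Representation ℝ H (lieM E H) where
  toFun h := ((Ad E G h).restrictScalars ℝ).restrict fun _ hX => Ad_mem_lieM E H h hX
  map_one' := by ext; simp
  map_mul' h k := by
    ext X
    change Ad E G ((h * k : H) : G) X = Ad E G h (Ad E G k X)
    rw [Subgroup.coe_mul, map_mul]
    rfl

/-- The tangent bundle `T(G/H) = G ×_{Ad_{|H}} 𝔪`. -/
abbrev TGH (H : Subgroup G) : Type _ := AssocBundle (isotropyRep E H)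

variable {E} {H : Subgroup G} (hH : IsCompactRealForm E H)

/-- The canonical connection form `α = p₁ ∘ ω_G` on `G → G/H`, where `p₁ : 𝔤 → 𝔥` is the
projection along `𝔪`. -/
def connForm (g : G) (ξ : TangentSpace 𝓘(ℂ, E) g) : lieH E H :=
  (lieH E H).projectionOnto (lieM E H) hH.isCompl (maurerCartan E g ξ)

/-- The differential of the projection `π : G → G/H`: a tangent vector `ξ` of `G` at `g` is mapped
to the class in `T(G/H)` of `g` and of the component in `𝔪` of `ω_G(ξ)`. -/
def dproj (g : G) (ξ : TangentSpace 𝓘(ℂ, E) g) : TGH E H :=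
  AssocBundle.mk (isotropyRep E H) g
    ((lieM E H).projectionOnto (lieH E H) hH.isCompl.symm (maurerCartan E g ξ))

end RealForm

/-! ### The lift of the adjoint representation and the spinor bundle -/

section Spinors

variable (E : Type*) [NormedAddCommGroup E] [NormedSpace ℂ E] [FiniteDimensional ℂ E]
  (G : Type*) [TopologicalSpace G] [ChartedSpace E G] [Group G] [LieGroup 𝓘(ℂ, E) ω G]

/-- A lift of the adjoint representation of `G` to `Spin(𝔤)`: a continuous morphism of groups
`G → Spin(𝔤)` whose composition with the covering `a ↦ (v ↦ a v a⁻¹)` of `SO(𝔤)` by `Spin(𝔤)`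
is `Ad`. -/
structure AdLift (lam : Set.Ioi (0 : ℝ)) extends G →* Cl E G lam where
  mem_spin : ∀ g, toFun g ∈ spin E G lam
  continuous : Continuous toFun
  lift : ∀ g v, toFun g * vec E G lam v * toFun g⁻¹ = vec E G lam (Ad E G g v)

variable {E G} {lam : Set.Ioi (0 : ℝ)} (L : AdLift E G lam) (H : Subgroup G)

/-- The representation `ρ` of `H` on `Cl(𝔤)`: `ρ(h)` is the multiplication on the left by the lift
of `Ad(h)`. -/
def spinorRep : Representation ℂ H (Cl E G lam) :=
  (Algebra.lmul ℂ (Cl E G lam) : Cl E G lam →* Module.End ℂ (Cl E G lam)).comp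
    (L.toMonoidHom.comp H.subtype)

/-- The natural extension of `Ad_{|H}` to `Cl(𝔤)`: `h` acts by conjugation by the lift of `Ad(h)`,
and thus by the algebra automorphism which extends `Ad(h) : 𝔤 → 𝔤`. -/
def cliffordRep : Representation ℂ H (Cl E G lam) where
  toFun h := LinearMap.mulRight ℂ (L.toMonoidHom (h : G)⁻¹) ∘ₗ
    LinearMap.mulLeft ℂ (L.toMonoidHom (h : G))
  map_one' := by ext; simp
  map_mul' h k := by ext; simp [mul_assoc]

/-- The spinor bundle `Σ = G ×_ρ Cl(𝔤)`. -/
abbrev SpinorBundle : Type _ := AssocBundle (spinorRep L H)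

/-- The Clifford bundle `Cl_Σ = G ×_{Ad_{|H}} Cl(𝔤)`. -/
abbrev CliffordBundle : Type _ := AssocBundle (cliffordRep L H)

/-- The class `[g, v]` in the spinor bundle. -/
abbrev spinorMk (g : G) (v : Cl E G lam) : SpinorBundle L H := AssocBundle.mk (spinorRep L H) g v

/-- The bundle `UΣ = G ×_ρ Ãd(G) ⊂ Σ` of unit spinors. -/
def unitSpinors : Set (SpinorBundle L H) :=
  {z | ∃ g a : G, z = spinorMk L H g (L.toMonoidHom a)}

variable {H}

theorem lift_mul (a b : G) : L.toMonoidHom a * L.toMonoidHom b = L.toMonoidHom (a * b) :=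
  (map_mul _ _ _).symm

/-- The Clifford action `Cl_Σ × Σ → Σ`, `[g, η] · [g, v] = [g, η v]`. It is used for elements
above the same point of `G / H`: a second representative `(g', v)` with `g' ∈ g H` is first replaced
by the equivalent pair `(g, ρ(g⁻¹ g') v)`. -/
def cliffordMul : CliffordBundle L H → SpinorBundle L H → SpinorBundle L H :=
  Quotient.lift₂ (s₁ := assocSetoid (cliffordRep L H)) (s₂ := assocSetoid (spinorRep L H))
    (fun p q : G × Cl E G lam =>
      spinorMk L H p.1 (p.2 * (L.toMonoidHom (p.1⁻¹ * q.1) * q.2))) (by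
    rintro ⟨g, a⟩ ⟨g', v⟩ _ _ ⟨h, rfl⟩ ⟨h', rfl⟩
    refine Quotient.sound ⟨h, ?_⟩
    simp only [spinorRep, cliffordRep, MonoidHom.coe_comp, Function.comp_apply,
      Subgroup.coe_subtype, MonoidHom.coe_mk, OneHom.coe_mk, LinearMap.comp_apply,
      LinearMap.mulLeft_apply, LinearMap.mulRight_apply,
      MonoidHom.coe_coe, Algebra.coe_lmul_eq_mul, LinearMap.mul_apply']
    refine Prod.ext rfl ?_
    simp only [mul_assoc, Subgroup.coe_inv, inv_inv]
    congr 2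
    simp only [← mul_assoc, lift_mul]
    congr 2
    group)

theorem cliffordMul_mk (g : G) (a v : Cl E G lam) :
    cliffordMul L (AssocBundle.mk (cliffordRep L H) g a) (spinorMk L H g v)
      = spinorMk L H g (a * v) := by
  change spinorMk L H g (a * (L.toMonoidHom (g⁻¹ * g) * v)) = _
  simp

variable [LieAlgebra.IsSemisimple ℂ (LieAlg E G)]

theorem bivector_Ad (g : G) (u : LieAlg E G) :
    bivector E G lam (LieAlgebra.ad ℂ _ (Ad E G g u))
      = L.toMonoidHom g * bivector E G lam (LieAlgebra.ad ℂ _ u) * L.toMonoidHom g⁻¹ := by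
  have hinv : Ad E G g⁻¹ * Ad E G g = 1 ∧ Ad E G g * Ad E G g⁻¹ = 1 := by
    constructor <;> rw [← map_mul] <;> simp
  let A : LieAlg E G ≃ₗ[ℂ] LieAlg E G :=
    LinearEquiv.ofLinearMap (Ad E G g) (Ad E G g⁻¹) hinv.2 hinv.1
  have hA : ∀ v, A v = Ad E G g v := fun v => rfl
  have hf : IsOrthonormalBasis E G lam ((onb E G lam).map A) := by
    intro i j
    rw [Module.Basis.map_apply, Module.Basis.map_apply, hA, hA, formB_Ad]
    exact onb_spec E G lam i j
  have hL : ∀ v, vec E G lam (Ad E G g v) = L.toMonoidHom g * vec E G lam v * L.toMonoidHom g⁻¹ :=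
    fun v => (L.lift g v).symm
  rw [bivector_eq E G lam _ _ hf, bivector]
  simp only [Module.Basis.map_apply, hA, LieAlgebra.ad_apply, ← Ad_lie]
  simp only [hL, mul_smul_comm, smul_mul_assoc, Finset.mul_sum, Finset.sum_mul]
  congr 1
  refine Finset.sum_congr rfl fun j _ => ?_
  have h1 : L.toMonoidHom g⁻¹ * L.toMonoidHom g = 1 := by rw [lift_mul]; simp
  calc _ = L.toMonoidHom g * vec E G lam (onb E G lam j) *
        (L.toMonoidHom g⁻¹ * L.toMonoidHom g) * vec E G lam ⁅u, onb E G lam j⁆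
          * L.toMonoidHom g⁻¹ := by simp only [mul_assoc]
    _ = _ := by rw [h1]; simp only [mul_assoc, one_mul]

/-- The adjoint map on `G/H`, `ad : T(G/H) → Cl_Σ`, `[g, u] ↦ [g, ad(u)]`, with
`ad(u) ∈ Λ²𝔤 ⊂ Cl(𝔤)`. -/
def adMap : TGH E H → CliffordBundle L H :=
  Quotient.map' (s₁ := assocSetoid (isotropyRep E H)) (s₂ := assocSetoid (cliffordRep L H))
    (fun p => (p.1, bivector E G lam (LieAlgebra.ad ℂ (LieAlg E G) (p.2 : LieAlg E G)))) (by
      rintro ⟨g, u⟩ _ ⟨h, rfl⟩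
      refine ⟨h, Prod.ext rfl ?_⟩
      have := bivector_Ad L (h : G)⁻¹ (u : LieAlg E G)
      exact this)

/-- The differential `ρ_* : 𝔥 → End(Cl(𝔤))` of `ρ` at the identity: the multiplication on the left
by the differential of the lift of `Ad`. -/
def rhoStar (A : lieH E H) (v : Cl E G lam) : Cl E G lam :=
  (show E →L[ℝ] Cl E G lam from
    mfderiv 𝓘(ℝ, E) 𝓘(ℝ, Cl E G lam) (fun g : G => L.toMonoidHom g) 1) (A : LieAlg E G) * v

/-- A smooth section `φ` of the spinor bundle: `φ(g H) = [g, f(g)]` lies above `g H` and `f` is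
smooth. -/
def IsSmoothSection (φ : G ⧸ H → SpinorBundle L H) : Prop :=
  ∃ f : G → Cl E G lam, ContMDiff 𝓘(ℝ, E) 𝓘(ℝ, Cl E G lam) ∞ f ∧
    ∀ g : G, φ g = spinorMk L H g (f g)

/-- `∇ᵒ_X φ = D`, for the connection `∇ᵒ` on `Σ` associated with the canonical connection form
`α`: along every curve `γ` of frames in `G` whose projection to `G/H` is tangent to `X` at `t = 0`,
one has `φ = [γ, f]` with `f` differentiable at `0`, and
`D = [γ(0), f'(0) + ρ_*(α(γ'(0))) f(0)]`. -/
def HasCovDeriv (hH : IsCompactRealForm E H) (φ : G ⧸ H → SpinorBundle L H) (X : TGH E H)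
    (D : SpinorBundle L H) : Prop :=
  ∀ (γ : ℝ → G) (ξ : TangentSpace 𝓘(ℂ, E) (γ 0)), HasVelocityAt E γ 0 ξ → dproj hH (γ 0) ξ = X →
    ∃ (f : ℝ → Cl E G lam) (f' : Cl E G lam), (∀ t, φ (γ t) = spinorMk L H (γ t) (f t)) ∧
      HasDerivAt f f' 0 ∧
      D = spinorMk L H (γ 0) (f' + rhoStar L (connForm hH (γ 0) ξ) (f 0))

end Spinors

end SymSpin

end

/-! Existence of the lift is a covering argument. `Ad(g)` preserves `B`, and the pairs `(g, a)`,
with `a` an even Clifford element of spinor norm one that induces `Ad(g)`, form a group over `G`.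
Its kernel lies in `{1, -1}`: an even element commuting with all vectors is scalar
(`exists_eq_algebraMap_of_even`), and the norm makes that scalar a sign. Writing orthogonal maps
near the identity as products of reflections that vary analytically gives a local section with
values in `Spin(𝔤)` (`exists_local_lift`), so the projection to `G` is a covering. Since `G` is
simply connected, the identity of `G` lifts through it. Multiplicativity and uniqueness then hold
because the discrepancy is a continuous sign on a connected space, equal to `1` at the identity;
values in `Spin(𝔤)` form a subgroup containing a neighbourhood of the identity, hence everything.

The differential of the lift `L` is found algebraically (`AdLift.deriv_eq`). Since the differential
of `Ad` is the bracket, `L_*(u)` and half the bivector of `ad(u)` have the same commutators with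
vectors. Their difference is even, hence scalar, and reversal changes its sign, so it vanishes.

Finally, let `γ` be a curve of frames with `ω_G(γ') = A + m`, where `A ∈ 𝔥` and `m ∈ 𝔪`. The
function `L(γ⁻¹)` has derivative `-L_*(A + m) L(γ⁻¹)`. The connection term adds `L_*(A) L(γ⁻¹)`, and
what survives is `-L_*(m) L(γ⁻¹)`, which is half of `-ad(m) · φ`. -/

noncomputable section

namespace SymSpin

/-! ### The differential of the adjoint representation, in a chart at the identity. -/

section AdjointDerivative

open Filter Topology VectorField

variable (E : Type*) [NormedAddCommGroup E] [NormedSpace ℂ E]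
  (G : Type*) [TopologicalSpace G] [ChartedSpace E G] [Group G]

/-- The chart of `G` at the identity. -/
abbrev idChart : G → E := extChartAt 𝓘(ℂ, E) (1 : G)

/-- The inverse of the chart of `G` at the identity. -/
abbrev idChartSymm : E → G := (extChartAt 𝓘(ℂ, E) (1 : G)).symm

/-- The multiplication of `G` in the chart at the identity. -/
def chartMul (p : E × E) : E := idChart E G (idChartSymm E G p.1 * idChartSymm E G p.2)

/-- The derivative of `y ↦ x y` at the identity, in the chart at the identity. -/
def chartLeft (x : E) : E →L[ℂ] E :=
  (fderiv ℂ (chartMul E G) (x, idChart E G 1)).comp (ContinuousLinearMap.inr ℂ E E)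

/-- The derivative of `y ↦ y x` at the identity, in the chart at the identity. -/
def chartRight (x : E) : E →L[ℂ] E :=
  (fderiv ℂ (chartMul E G) (idChart E G 1, x)).comp (ContinuousLinearMap.inl ℂ E E)

theorem idChartSymm_one : idChartSymm E G (idChart E G 1) = 1 := by simp

theorem eventually_idChart_idChartSymm :
    ∀ᶠ x in 𝓝 (idChart E G 1), idChart E G (idChartSymm E G x) = x := by
  filter_upwards [extChartAt_target_mem_nhds (I := 𝓘(ℂ, E)) (1 : G)] with x hx
  exact (extChartAt 𝓘(ℂ, E) (1 : G)).right_inv hx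

/-- The adjoint representation in the chart at the identity. -/
def chartAd (x : E) : E →L[ℂ] E := conjDeriv E (idChartSymm E G x)

theorem chartAd_idChart_one : chartAd E G (idChart E G 1) = ContinuousLinearMap.id ℂ E := by
  rw [chartAd, idChartSymm_one]
  exact conjDeriv_one E

theorem contMDiffAt_idChart : ContMDiffAt 𝓘(ℂ, E) 𝓘(ℂ, E) ω (idChart E G) 1 :=
  contMDiffAt_extChartAt

variable [LieGroup 𝓘(ℂ, E) ω G]

theorem contMDiffAt_idChartSymm :
    ContMDiffAt 𝓘(ℂ, E) 𝓘(ℂ, E) ω (idChartSymm E G) (idChart E G 1) :=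
  (contMDiffOn_extChartAt_symm (1 : G)).contMDiffAt (extChartAt_target_mem_nhds 1)

theorem eventually_mdiff_idChartSymm :
    ∀ᶠ x in 𝓝 (idChart E G 1), MDifferentiableAt 𝓘(ℂ, E) 𝓘(ℂ, E) (idChartSymm E G) x := by
  filter_upwards [eventually_eventually_nhds.2 (extChartAt_target_mem_nhds (I := 𝓘(ℂ, E)) (1 : G))]
    with x hx
  exact ((contMDiffOn_extChartAt_symm (n := ω) (1 : G)).contMDiffAt hx).mdifferentiableAt (by simp)

theorem hasMFDerivAt_idChart :
    HasMFDerivAt 𝓘(ℂ, E) 𝓘(ℂ, E) (idChart E G) 1 (ContinuousLinearMap.id ℂ E) := by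
  have h := ((contMDiffAt_idChart E G).mdifferentiableAt (by simp)).hasMFDerivAt
  rwa [mfderiv_extChartAt_self] at h

theorem hasMFDerivAt_idChartSymm :
    HasMFDerivAt 𝓘(ℂ, E) 𝓘(ℂ, E) (idChartSymm E G) (idChart E G 1)
      (ContinuousLinearMap.id ℂ E) := by
  have h := ((contMDiffAt_idChartSymm E G).mdifferentiableAt (by simp)).hasMFDerivAt
  have h2 := mfderivWithin_range_extChartAt_symm (I := 𝓘(ℂ, E)) (x := (1 : G))
  simp only [modelWithCornersSelf_coe, Set.range_id, mfderivWithin_univ] at h2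
  rwa [h2] at h

theorem contDiffAt_chartMul :
    ContDiffAt ℂ ω (chartMul E G) (idChart E G 1, idChart E G 1) := by
  rw [← contMDiffAt_iff_contDiffAt]
  have h1 : ContMDiffAt 𝓘(ℂ, E × E) 𝓘(ℂ, E) ω (fun p : E × E => idChartSymm E G p.1)
      (idChart E G 1, idChart E G 1) :=
    ContMDiffAt.comp (idChart E G 1, idChart E G 1) (g := idChartSymm E G) (f := Prod.fst)
      (contMDiffAt_idChartSymm E G) contDiff_fst.contMDiff.contMDiffAt
  have h2 : ContMDiffAt 𝓘(ℂ, E × E) 𝓘(ℂ, E) ω (fun p : E × E => idChartSymm E G p.2)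
      (idChart E G 1, idChart E G 1) :=
    ContMDiffAt.comp (idChart E G 1, idChart E G 1) (g := idChartSymm E G) (f := Prod.snd)
      (contMDiffAt_idChartSymm E G) contDiff_snd.contMDiff.contMDiffAt
  have h3 := h1.mul h2
  refine ContMDiffAt.comp_of_eq (x := (idChart E G 1, idChart E G 1)) (g := idChart E G)
    (contMDiffAt_idChart E G) h3 ?_
  simp

/-- The second derivative of the multiplication at the identity, in the chart at the identity. -/
def chartMulSnd : E × E →L[ℂ] E × E →L[ℂ] E :=
  fderiv ℂ (fderiv ℂ (chartMul E G)) (idChart E G 1, idChart E G 1)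

theorem chartMulSnd_symm (p q : E × E) : chartMulSnd E G p q = chartMulSnd E G q p :=
  (contDiffAt_chartMul E G).isSymmSndFDerivAt (by simp) p q

theorem hasFDerivAt_fderiv_chartMul :
    HasFDerivAt (fderiv ℂ (chartMul E G)) (chartMulSnd E G) (idChart E G 1, idChart E G 1) :=
  (((contDiffAt_chartMul E G).fderiv_right (m := ω) (by simp)).differentiableAt
    (by simp)).hasFDerivAt

theorem contDiffAt_chartLeft : ContDiffAt ℂ ω (chartLeft E G) (idChart E G 1) := by
  have h := (contDiffAt_chartMul E G).fderiv_right (m := ω) (by simp)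
  have h2 : ContDiffAt ℂ ω (fun x => fderiv ℂ (chartMul E G) (x, idChart E G 1)) (idChart E G 1) :=
    ContDiffAt.comp (g := fderiv ℂ (chartMul E G)) (f := fun x => (x, idChart E G 1))
      (idChart E G 1) h (contDiffAt_id.prodMk contDiffAt_const)
  exact h2.clm_comp contDiffAt_const

theorem contDiffAt_chartRight : ContDiffAt ℂ ω (chartRight E G) (idChart E G 1) := by
  have h := (contDiffAt_chartMul E G).fderiv_right (m := ω) (by simp)
  have h2 : ContDiffAt ℂ ω (fun x => fderiv ℂ (chartMul E G) (idChart E G 1, x)) (idChart E G 1) :=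
    ContDiffAt.comp (g := fderiv ℂ (chartMul E G)) (f := fun x => (idChart E G 1, x))
      (idChart E G 1) h (contDiffAt_const.prodMk contDiffAt_id)
  exact h2.clm_comp contDiffAt_const

theorem hasFDerivAt_chartLeft_apply (v : E) :
    HasFDerivAt (fun x => chartLeft E G x v)
      ((chartMulSnd E G).flip (0, v) ∘L ContinuousLinearMap.inl ℂ E E) (idChart E G 1) := by
  have h : HasFDerivAt (fun x : E => (x, idChart E G 1)) (ContinuousLinearMap.inl ℂ E E)
    (idChart E G 1) := (hasFDerivAt_id _).prodMk (hasFDerivAt_const _ _)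
  have h2 := (HasFDerivAt.comp (g := fderiv ℂ (chartMul E G))
    (f := fun x => (x, idChart E G 1)) (idChart E G 1)
    (hasFDerivAt_fderiv_chartMul E G) h).clm_apply
    (hasFDerivAt_const ((0, v) : E × E) _)
  refine h2.congr_fderiv ?_
  ext w
  simp

theorem hasFDerivAt_chartRight_apply (v : E) :
    HasFDerivAt (fun x => chartRight E G x v)
      ((chartMulSnd E G).flip (v, 0) ∘L ContinuousLinearMap.inr ℂ E E) (idChart E G 1) := by
  have h : HasFDerivAt (fun x : E => (idChart E G 1, x)) (ContinuousLinearMap.inr ℂ E E)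
    (idChart E G 1) := (hasFDerivAt_const _ _).prodMk (hasFDerivAt_id _)
  have h2 := (HasFDerivAt.comp (g := fderiv ℂ (chartMul E G)) (idChart E G 1)
    (hasFDerivAt_fderiv_chartMul E G) h).clm_apply
    (hasFDerivAt_const ((v, 0) : E × E) _)
  refine h2.congr_fderiv ?_
  ext w
  simp

theorem eventually_hasFDerivAt_chartMul_left :
    ∀ᶠ x in 𝓝 (idChart E G 1), HasFDerivAt (fun y => chartMul E G (x, y)) (chartLeft E G x)
      (idChart E G 1) := by
  have h : ∀ᶠ p in 𝓝 (idChart E G 1, idChart E G 1), DifferentiableAt ℂ (chartMul E G) p := by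
    filter_upwards [(contDiffAt_chartMul E G).eventually (by simp)] with p hp
    exact hp.differentiableAt (by simp)
  have hc : ContinuousAt (fun x : E => (x, idChart E G 1)) (idChart E G 1) := by fun_prop
  filter_upwards [hc.eventually h] with x hx
  exact HasFDerivAt.comp (g := chartMul E G) (f := fun y => (x, y)) (idChart E G 1) hx.hasFDerivAt
    (hasFDerivAt_prodMk_right x _)

theorem eventually_hasFDerivAt_chartMul_right :
    ∀ᶠ x in 𝓝 (idChart E G 1), HasFDerivAt (fun y => chartMul E G (y, x)) (chartRight E G x)
      (idChart E G 1) := by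
  have h : ∀ᶠ p in 𝓝 (idChart E G 1, idChart E G 1), DifferentiableAt ℂ (chartMul E G) p := by
    filter_upwards [(contDiffAt_chartMul E G).eventually (by simp)] with p hp
    exact hp.differentiableAt (by simp)
  have hc : ContinuousAt (fun x : E => (idChart E G 1, x)) (idChart E G 1) := by fun_prop
  filter_upwards [hc.eventually h] with x hx
  exact HasFDerivAt.comp (g := chartMul E G) (f := fun y => (y, x)) (idChart E G 1) hx.hasFDerivAt
    (hasFDerivAt_prodMk_left _ x)

theorem chartLeft_idChart_one : chartLeft E G (idChart E G 1) = ContinuousLinearMap.id ℂ E := by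
  refine (eventually_hasFDerivAt_chartMul_left E G).self_of_nhds.unique ?_
  refine (hasFDerivAt_id _).congr_of_eventuallyEq ?_
  filter_upwards [eventually_idChart_idChartSymm E G] with x hx
  rw [chartMul, idChartSymm_one, one_mul, hx]
  rfl

theorem chartRight_idChart_one : chartRight E G (idChart E G 1) = ContinuousLinearMap.id ℂ E := by
  refine (eventually_hasFDerivAt_chartMul_right E G).self_of_nhds.unique ?_
  refine (hasFDerivAt_id _).congr_of_eventuallyEq ?_
  filter_upwards [eventually_idChart_idChartSymm E G] with x hx
  rw [chartMul, idChartSymm_one, mul_one, hx]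
  rfl

/-- This is the derivative in `y` at the identity of `(x y x⁻¹) x = x y`. It expresses `Ad` through
partial derivatives of the multiplication alone, which gives both its analyticity and its
differential. -/
theorem eventually_chartRight_comp_chartAd :
    ∀ᶠ x in 𝓝 (idChart E G 1), chartRight E G x ∘L chartAd E G x = chartLeft E G x := by
  filter_upwards [eventually_hasFDerivAt_chartMul_left E G,
    eventually_hasFDerivAt_chartMul_right E G] with x hl hr
  set g := idChartSymm E G x with hg
  have hconj : HasMFDerivAt 𝓘(ℂ, E) 𝓘(ℂ, E) (fun y : G => g * y * g⁻¹) 1 (chartAd E G x) :=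
    (mdiff_conj E g 1).hasMFDerivAt
  have e1 : g * 1 * g⁻¹ = 1 := by simp
  have h1 := HasMFDerivAt.comp (I'' := 𝓘(ℂ, E)) (x := idChart E G 1) (g := fun y : G => g * y * g⁻¹)
    (g' := chartAd E G x)
    (by rw [idChartSymm_one]; exact hconj) (hasMFDerivAt_idChartSymm E G)
  have e2 : ((fun y : G => g * y * g⁻¹) ∘ idChartSymm E G) (idChart E G 1) = 1 := by
    simp
  have h2 := HasMFDerivAt.comp (I'' := 𝓘(ℂ, E)) (x := idChart E G 1) (g := idChart E G)
    (g' := ContinuousLinearMap.id ℂ E) (by rw [e2]; exact hasMFDerivAt_idChart E G) h1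
  have h3 : HasFDerivAt (fun y => idChart E G (g * idChartSymm E G y * g⁻¹)) (chartAd E G x)
    (idChart E G 1) := hasMFDerivAt_iff_hasFDerivAt.1 h2
  have e3 : idChart E G (g * idChartSymm E G (idChart E G 1) * g⁻¹) = idChart E G 1 := by simp
  have h4 := HasFDerivAt.comp (x := idChart E G 1) (g := fun y => chartMul E G (y, x))
    (g' := chartRight E G x) (by rw [e3]; exact hr) h3
  refine h4.unique (hl.congr_of_eventuallyEq ?_)
  have hcont : ContinuousAt (fun y => g * idChartSymm E G y * g⁻¹) (idChart E G 1) :=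
    h1.continuousAt
  have hs : ∀ᶠ z in 𝓝 (1 : G), idChartSymm E G (idChart E G z) = z := by
    filter_upwards [extChartAt_source_mem_nhds (I := 𝓘(ℂ, E)) (1 : G)] with z hz
    exact (extChartAt 𝓘(ℂ, E) (1 : G)).left_inv hz
  rw [ContinuousAt, show g * idChartSymm E G (idChart E G 1) * g⁻¹ = 1 from e2] at hcont
  filter_upwards [hcont.eventually hs] with y hy
  simp only [Function.comp_apply, chartMul]
  rw [hy, ← hg]
  simp [mul_assoc]

theorem eventually_isInvertible_mfderiv_idChartSymm :
    ∀ᶠ x in 𝓝 (idChart E G 1),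
      (mfderiv 𝓘(ℂ, E) 𝓘(ℂ, E) (idChartSymm E G) x).IsInvertible := by
  filter_upwards [extChartAt_target_mem_nhds (I := 𝓘(ℂ, E)) (1 : G)] with x hx
  have := isInvertible_mfderivWithin_extChartAt_symm hx
  simpa only [modelWithCornersSelf_coe, Set.range_id, mfderivWithin_univ] using this

/-- Differentiating in `y` the relation between `chartMul` and the product of `G` shows that
left-invariant fields are read in the chart through `chartLeft`. -/
theorem eventually_mpullback_mulInvariantVectorField (v : LieAlg E G) :
    ∀ᶠ x in 𝓝 (idChart E G 1),
      (mpullback 𝓘(ℂ, E) 𝓘(ℂ, E) (idChartSymm E G) (mulInvariantVectorField v) x : E)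
        = chartLeft E G x v := by
  have hs : ∀ᶠ z in 𝓝 (1 : G), idChartSymm E G (idChart E G z) = z := by
    filter_upwards [extChartAt_source_mem_nhds (I := 𝓘(ℂ, E)) (1 : G)] with z hz
    exact (extChartAt 𝓘(ℂ, E) (1 : G)).left_inv hz
  have hc := (contMDiffAt_idChartSymm E G).continuousAt
  rw [ContinuousAt, idChartSymm_one] at hc
  filter_upwards [eventually_hasFDerivAt_chartMul_left E G, eventually_mdiff_idChartSymm E G,
    eventually_isInvertible_mfderiv_idChartSymm E G, eventually_idChart_idChartSymm E G,
    hc.eventually (eventually_eventually_nhds.2 hs)] with x hl hd hinv hx hsx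
  set g := idChartSymm E G x with hg
  have e3 : chartMul E G (x, idChart E G 1) = x := by
    rw [chartMul, idChartSymm_one, mul_one, hx]
  have h1 := HasMFDerivAt.comp (I'' := 𝓘(ℂ, E)) (x := idChart E G 1) (g := idChartSymm E G)
    (g' := mfderiv 𝓘(ℂ, E) 𝓘(ℂ, E) (idChartSymm E G) x) (by rw [e3]; exact hd.hasMFDerivAt)
    (hasMFDerivAt_iff_hasFDerivAt.2 hl)
  have h2 := HasMFDerivAt.comp (I'' := 𝓘(ℂ, E)) (x := idChart E G 1) (g := fun y : G => g * y)
    (g' := mfderiv 𝓘(ℂ, E) 𝓘(ℂ, E) (fun y : G => g * y) 1)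
    (by rw [idChartSymm_one]; exact (mdiff_mul_left E g 1).hasMFDerivAt)
    (hasMFDerivAt_idChartSymm E G)
  have hcont : ContinuousAt (fun y => g * idChartSymm E G y) (idChart E G 1) := h2.continuousAt
  rw [ContinuousAt, idChartSymm_one, mul_one] at hcont
  have h3 : (fun y : G => g * y) ∘ idChartSymm E G =ᶠ[𝓝 (idChart E G 1)]
      idChartSymm E G ∘ fun y => chartMul E G (x, y) := by
    filter_upwards [hcont.eventually hsx] with y hy
    exact hy.symm
  have h4 := hasMFDerivAt_unique (h1.congr_of_eventuallyEq h3) h2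
  have h5 := congrArg (fun T : E →L[ℂ] E => T v) h4
  obtain ⟨e, he⟩ := hinv
  rw [← he] at h5
  rw [mpullback_apply, ← he, ContinuousLinearMap.inverse_equiv]
  exact (e.symm_apply_eq).2 h5.symm

variable [FiniteDimensional ℂ E]

theorem eventually_chartAd_eq :
    ∀ᶠ x in 𝓝 (idChart E G 1),
      chartAd E G x = (chartRight E G x).inverse ∘L chartLeft E G x := by
  have hopen : ∀ᶠ T in 𝓝 (ContinuousLinearMap.id ℂ E), T.IsInvertible :=
    (ContinuousLinearEquiv.refl ℂ E).nhds
  have hc := (contDiffAt_chartRight E G).continuousAt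
  rw [ContinuousAt, chartRight_idChart_one] at hc
  filter_upwards [hc.eventually hopen, eventually_chartRight_comp_chartAd E G] with x hx h
  rw [← h, ← ContinuousLinearMap.comp_assoc, hx.inverse_comp_self, ContinuousLinearMap.id_comp]

theorem contDiffAt_chartAd : ContDiffAt ℂ ω (chartAd E G) (idChart E G 1) := by
  refine ContDiffAt.congr_of_eventuallyEq ?_ (eventually_chartAd_eq E G)
  refine ContDiffAt.clm_comp ?_ (contDiffAt_chartLeft E G)
  refine ContDiffAt.comp (g := ContinuousLinearMap.inverse) _ ?_ (contDiffAt_chartRight E G)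
  rw [chartRight_idChart_one]
  exact contDiffAt_map_inverse (ContinuousLinearEquiv.refl ℂ E)

/-- Apply the product rule to `chartRight x (chartAd x v) = chartLeft x v` at the identity, where
all three operators are the identity; the symmetry of the second derivative puts the `chartRight`
term in the stated form. -/
theorem fderiv_chartAd_apply (u v : E) :
    fderiv ℂ (chartAd E G) (idChart E G 1) u v
      = chartMulSnd E G (u, 0) (0, v) - chartMulSnd E G (v, 0) (0, u) := by
  have hA := ((contDiffAt_chartAd E G).differentiableAt (by simp)).hasFDerivAt
  have hR := ((contDiffAt_chartRight E G).differentiableAt (by simp)).hasFDerivAt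
  have h1 := hR.clm_apply (hA.clm_apply (hasFDerivAt_const v _))
  have h2 := (hasFDerivAt_chartLeft_apply E G v).congr_of_eventuallyEq
    ((eventually_chartRight_comp_chartAd E G).mono fun x hx =>
      congrArg (fun T : E →L[ℂ] E => T v) hx)
  have h3 := congrArg (fun T : E →L[ℂ] E => T u) (h1.unique h2)
  have h4 := (hasFDerivAt_chartRight_apply E G v).unique (hR.clm_apply (hasFDerivAt_const v _))
  have h5 := congrArg (fun T : E →L[ℂ] E => T u) h4
  simp [chartAd_idChart_one, chartRight_idChart_one] at h3 h5
  rw [eq_sub_iff_add_eq, chartMulSnd_symm E G (v, 0), h5, h3]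

theorem lieBracket_chartLeft (u v : E) :
    lieBracket ℂ (fun x => chartLeft E G x u) (fun x => chartLeft E G x v) (idChart E G 1)
      = fderiv ℂ (chartAd E G) (idChart E G 1) u v := by
  rw [fderiv_chartAd_apply, lieBracket,
    (hasFDerivAt_chartLeft_apply E G u).fderiv, (hasFDerivAt_chartLeft_apply E G v).fderiv,
    chartLeft_idChart_one]
  simp

/-- The differential of the adjoint representation is the Lie bracket. -/
theorem bracket_eq_fderiv_chartAd (u v : LieAlg E G) :
    (⁅u, v⁆ : LieAlg E G) = (fderiv ℂ (chartAd E G) (idChart E G 1) u v : E) := by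
  have hw : ∀ V W : E → E, lieBracketWithin ℂ V W
      (idChartSymm E G ⁻¹' Set.univ ∩ Set.range 𝓘(ℂ, E)) = lieBracket ℂ V W := by
    intro V W
    simp
  have hp : ∀ V : (g : G) → TangentSpace 𝓘(ℂ, E) g,
      mpullbackWithin 𝓘(ℂ, E) 𝓘(ℂ, E) (idChartSymm E G) V (Set.range 𝓘(ℂ, E))
        = mpullback 𝓘(ℂ, E) 𝓘(ℂ, E) (idChartSymm E G) V := by
    intro V
    simp
  have h1 := Filter.EventuallyEq.lieBracket_vectorField_eq (𝕜 := ℂ)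
    (eventually_mpullback_mulInvariantVectorField E G u)
    (eventually_mpullback_mulInvariantVectorField E G v)
  -- The bracket of `𝔤` is that of left-invariant fields at the identity. It is computed in the
  -- chart there, whose differential at that point is the identity.
  rw [GroupLieAlgebra.bracket_def, mlieBracket, mlieBracketWithin_apply,
    mfderiv_extChartAt_self, hp, hp]
  refine (congrArg (fun T : E →L[ℂ] E => T _) ContinuousLinearMap.inverse_id).trans ?_
  exact (congrFun (hw _ _) _).trans (h1.trans (lieBracket_chartLeft E G u v))

end AdjointDerivative

/-! ### The twisted centre of a Clifford algebra. -/

section CliffordCenter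

open CliffordAlgebra

variable {V : Type*} [AddCommGroup V] [Module ℂ V] {Q : QuadraticForm ℂ V}

theorem involute_mem_adjoin_ι {t : Set V} {x : CliffordAlgebra Q}
    (hx : x ∈ Algebra.adjoin ℂ (ι Q '' t)) : involute x ∈ Algebra.adjoin ℂ (ι Q '' t) := by
  induction hx using Algebra.adjoin_induction with
  | mem x hx =>
    obtain ⟨v, hv, rfl⟩ := hx
    rw [involute_ι]
    exact neg_mem (Algebra.subset_adjoin ⟨v, hv, rfl⟩)
  | algebraMap r => rw [AlgHom.commutes]; exact Subalgebra.algebraMap_mem _ r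
  | add x y _ _ h1 h2 => rw [map_add]; exact add_mem h1 h2
  | mul x y _ _ h1 h2 => rw [map_mul]; exact mul_mem h1 h2

/-- Moving `u` past a generator orthogonal to it costs a sign, and `involute` records the total
sign. -/
theorem ι_mul_of_mem_adjoin_ι {u : V} {t : Set V} (hu : ∀ v ∈ t, QuadraticMap.polar Q u v = 0)
    {x : CliffordAlgebra Q} (hx : x ∈ Algebra.adjoin ℂ (ι Q '' t)) :
    ι Q u * x = involute x * ι Q u := by
  induction hx using Algebra.adjoin_induction with
  | mem x hx =>
    obtain ⟨v, hv, rfl⟩ := hx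
    have h := ι_mul_ι_add_swap (Q := Q) u v
    rw [hu v hv, map_zero] at h
    rw [involute_ι, neg_mul]
    exact eq_neg_of_add_eq_zero_left h
  | algebraMap r => rw [AlgHom.commutes, Algebra.commutes]
  | add x y _ _ h1 h2 => rw [map_add, mul_add, add_mul, h1, h2]
  | mul x y _ _ h1 h2 => rw [map_mul, ← mul_assoc, h1, mul_assoc, h2, mul_assoc]

/-- Elements `y + u z` are closed under products because `y u = u · involute y` and `u² = Q u`. -/
theorem exists_add_ι_mul_of_mem_adjoin_ι_insert {u : V} {t : Set V}
    (hu : ∀ v ∈ t, QuadraticMap.polar Q u v = 0) {x : CliffordAlgebra Q}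
    (hx : x ∈ Algebra.adjoin ℂ (ι Q '' insert u t)) :
    ∃ y ∈ Algebra.adjoin ℂ (ι Q '' t), ∃ z ∈ Algebra.adjoin ℂ (ι Q '' t), x = y + ι Q u * z := by
  induction hx using Algebra.adjoin_induction with
  | mem x hx =>
    obtain ⟨v, rfl | hv, rfl⟩ := hx
    · exact ⟨0, zero_mem _, 1, one_mem _, by simp⟩
    · exact ⟨ι Q v, Algebra.subset_adjoin ⟨v, hv, rfl⟩, 0, zero_mem _, by simp⟩
  | algebraMap r => exact ⟨algebraMap _ _ r, Subalgebra.algebraMap_mem _ r, 0, zero_mem _, by simp⟩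
  | add x y _ _ h1 h2 =>
    obtain ⟨y1, hy1, z1, hz1, rfl⟩ := h1
    obtain ⟨y2, hy2, z2, hz2, rfl⟩ := h2
    exact ⟨y1 + y2, add_mem hy1 hy2, z1 + z2, add_mem hz1 hz2, by rw [mul_add]; abel⟩
  | mul x y _ _ h1 h2 =>
    obtain ⟨y1, hy1, z1, hz1, rfl⟩ := h1
    obtain ⟨y2, hy2, z2, hz2, rfl⟩ := h2
    have e : ∀ y ∈ Algebra.adjoin ℂ (ι Q '' t), y * ι Q u = ι Q u * involute y := by
      intro y hy
      rw [ι_mul_of_mem_adjoin_ι hu (involute_mem_adjoin_ι hy), involute_involute]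
    refine ⟨y1 * y2 + Q u • (involute z1 * z2),
      add_mem (mul_mem hy1 hy2) (Subalgebra.smul_mem _ (mul_mem (involute_mem_adjoin_ι hz1) hz2) _),
      involute y1 * z2 + z1 * y2,
      add_mem (mul_mem (involute_mem_adjoin_ι hy1) hz2) (mul_mem hz1 hy2), ?_⟩
    calc (y1 + ι Q u * z1) * (y2 + ι Q u * z2)
        = y1 * y2 + (y1 * ι Q u) * z2 + ι Q u * z1 * y2 + ι Q u * (z1 * ι Q u) * z2 := by
          noncomm_ring
      _ = y1 * y2 + ι Q u * involute y1 * z2 + ι Q u * z1 * y2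
            + (ι Q u * ι Q u) * (involute z1 * z2) := by
          rw [e y1 hy1, e z1 hz1]; simp only [mul_assoc]
      _ = _ := by
          rw [ι_sq_scalar, ← Algebra.smul_def, mul_add]
          simp only [mul_assoc]
          abel

/-- The basis vectors are eliminated one at a time from an expression of `x`. The twisted
commutation relation excludes the volume element in every dimension, whereas the ordinary centre
contains it in odd dimension. -/
theorem mem_bot_of_ι_mul_eq {n : ℕ} (e : Fin n → V)
    (he : ∀ i j, i ≠ j → QuadraticMap.polar Q (e i) (e j) = 0) (h0 : ∀ i, Q (e i) ≠ 0)
    {x : CliffordAlgebra Q} (hx : ∀ i, ι Q (e i) * x = involute x * ι Q (e i)) (s : Finset (Fin n))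
    (hs : x ∈ Algebra.adjoin ℂ (ι Q '' (e '' s))) : x ∈ (⊥ : Subalgebra ℂ (CliffordAlgebra Q)) := by
  classical
  induction s using Finset.induction_on with
  | empty => simpa using hs
  | insert a s ha ih =>
    have hu : ∀ v ∈ e '' s, QuadraticMap.polar Q (e a) v = 0 := by
      rintro _ ⟨j, hj, rfl⟩
      exact he a j (by rintro rfl; exact ha hj)
    rw [Finset.coe_insert, Set.image_insert_eq] at hs
    obtain ⟨y, hy, z, hz, rfl⟩ := exists_add_ι_mul_of_mem_adjoin_ι_insert hu hs
    have h1 := hx a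
    rw [map_add, map_mul, involute_ι, mul_add, add_mul, ι_mul_of_mem_adjoin_ι hu hy] at h1
    have h2 := add_left_cancel h1
    -- The part `y` satisfies the relation on its own; for `u z` the two sides are `Q(u) z` and
    -- `-Q(u) z`, so `2 Q(u) z = 0`.
    rw [neg_mul, neg_mul, mul_assoc, ← ι_mul_of_mem_adjoin_ι hu hz, ← mul_assoc, ι_sq_scalar,
      ← Algebra.smul_def, eq_neg_iff_add_eq_zero, ← two_smul ℂ, smul_smul] at h2
    have hz0 : z = 0 := (smul_eq_zero.1 h2).resolve_left (mul_ne_zero two_ne_zero (h0 a))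
    subst hz0
    rw [mul_zero, add_zero] at ih ⊢
    exact ih hy

end CliffordCenter

/-! ### Elements of `Spin(𝔤)` and the topology of `Cl(𝔤)`. -/

section CliffordFacts

open CliffordAlgebra

variable {E : Type*} [NormedAddCommGroup E] [NormedSpace ℂ E] [FiniteDimensional ℂ E]
  {G : Type*} [TopologicalSpace G] [ChartedSpace E G] [Group G] [LieGroup 𝓘(ℂ, E) ω G]
  {lam : Set.Ioi (0 : ℝ)}

theorem formB_comm (u v : LieAlg E G) : formB E G lam u v = formB E G lam v u := by
  simp only [formB, LinearMap.smul_apply]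
  rw [LieModule.traceForm_comm]

theorem cliffForm_apply (u : LieAlg E G) : cliffForm E G lam u = -formB E G lam u u := rfl

theorem polar_cliffForm (u v : LieAlg E G) :
    QuadraticMap.polar (cliffForm E G lam) u v = -2 * formB E G lam u v := by
  simp only [QuadraticMap.polar, cliffForm_apply, map_add, LinearMap.add_apply, formB_comm v u]
  ring

theorem vec_sq (u : LieAlg E G) (hu : formB E G lam u u = 1) :
    vec E G lam u * vec E G lam u = -1 := by
  rw [ι_sq_scalar, cliffForm_apply, hu]
  simp

/-- The even elements of the complex Clifford algebra which commute with the vectors are scalar. -/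
theorem exists_eq_algebraMap_of_even [LieAlgebra.IsSemisimple ℂ (LieAlg E G)] {x : Cl E G lam}
    (hx : involute x = x)
    (hc : ∀ v, x * vec E G lam v = vec E G lam v * x) : ∃ c : ℂ, x = algebraMap ℂ _ c := by
  have ho := onb_spec E G lam
  have h := mem_bot_of_ι_mul_eq (x := x) (onb E G lam)
    (fun i j hij => by rw [polar_cliffForm, ho, if_neg hij, mul_zero])
    (fun i => by rw [cliffForm_apply, ho, if_pos rfl]; simp)
    (fun i => by rw [hx, hc]) Finset.univ ?_
  · obtain ⟨c, hc⟩ := Algebra.mem_bot.1 h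
    exact ⟨c, hc.symm⟩
  · have : Algebra.adjoin ℂ (ι (cliffForm E G lam) '' (onb E G lam ''
        ((Finset.univ : Finset (Fin (Module.finrank ℂ (LieAlg E G)))) :
          Set (Fin (Module.finrank ℂ (LieAlg E G))))))
        = ⊤ := by
      rw [eq_top_iff, ← adjoin_range_ι]
      refine Algebra.adjoin_le ?_
      rintro _ ⟨v, rfl⟩
      rw [← (onb E G lam).sum_repr v, map_sum]
      refine sum_mem fun i _ => ?_
      rw [map_smul]
      exact Subalgebra.smul_mem _ (Algebra.subset_adjoin
        (Set.mem_image_of_mem _ (Set.mem_image_of_mem _ (by simp)))) _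
    rw [this]
    trivial

theorem involute_of_mem_spin {x : Cl E G lam} (hx : x ∈ spin E G lam) : involute x = x := by
  obtain ⟨l, hl, -, rfl⟩ := hx
  rw [involute_prod_map_ι, hl.neg_one_pow, one_smul]

/-- The product telescopes from the middle: each unit vector contributes its square `-1`, and there
is an even number of them. -/
theorem mul_reverse_of_mem_spin {x : Cl E G lam} (hx : x ∈ spin E G lam) :
    x * reverse x = 1 := by
  obtain ⟨l, hl, h1, rfl⟩ := hx
  have key : ∀ l : List (LieAlg E G), (∀ u ∈ l, formB E G lam u u = 1) →
      (l.map (vec E G lam)).prod * reverse (l.map (vec E G lam)).prod = (-1) ^ l.length := by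
    intro l
    induction l with
    | nil => simp
    | cons u l ih =>
      intro h
      have h2 := ih fun v hv => h v (List.mem_cons_of_mem _ hv)
      rw [List.map_cons, List.prod_cons, reverse.map_mul, reverse_ι, mul_assoc,
        ← mul_assoc _ _ (vec E G lam u), h2, List.length_cons, pow_succ',
        (Commute.neg_one_left (vec E G lam u)).pow_left l.length, ← mul_assoc,
        vec_sq u (h u List.mem_cons_self)]
  rw [key l h1, hl.neg_one_pow]

theorem one_mem_spin : (1 : Cl E G lam) ∈ spin E G lam := ⟨[], by simp⟩

theorem mul_mem_spin {x y : Cl E G lam} (hx : x ∈ spin E G lam) (hy : y ∈ spin E G lam) :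
    x * y ∈ spin E G lam := by
  obtain ⟨l, hl, h1, rfl⟩ := hx
  obtain ⟨l', hl', h1', rfl⟩ := hy
  refine ⟨l ++ l', by simpa using hl.add hl', fun u hu => ?_, by simp⟩
  rcases List.mem_append.1 hu with h | h
  exacts [h1 u h, h1' u h]

theorem vec_mul_vec_mem_spin {u v : LieAlg E G} (hu : formB E G lam u u = 1)
    (hv : formB E G lam v v = 1) : vec E G lam u * vec E G lam v ∈ spin E G lam :=
  ⟨[u, v], even_two, by simp [hu, hv], by simp⟩

theorem reverse_mem_spin {x : Cl E G lam} (hx : x ∈ spin E G lam) :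
    reverse x ∈ spin E G lam := by
  obtain ⟨l, hl, h1, rfl⟩ := hx
  exact ⟨l.reverse, by simpa, by simpa, by rw [reverse_prod_map_ι, List.map_reverse]⟩

variable (E G lam) in
/-- The multiplication of `Cl(𝔤)`, as a continuous bilinear map. -/
def mulCLM : Cl E G lam →L[ℂ] Cl E G lam →L[ℂ] Cl E G lam :=
  LinearMap.toContinuousLinearMap
    ((LinearMap.toContinuousLinearMap : (Cl E G lam →ₗ[ℂ] Cl E G lam) ≃ₗ[ℂ] _).toLinearMap ∘ₗ
      LinearMap.mul ℂ (Cl E G lam))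

theorem mulCLM_apply (x y : Cl E G lam) : mulCLM E G lam x y = x * y := rfl

variable (E G lam) in
/-- The inclusion `𝔤 → Cl(𝔤)`, as a continuous linear map. -/
def vecCLM : E →L[ℂ] Cl E G lam :=
  LinearMap.toContinuousLinearMap (show E →ₗ[ℂ] Cl E G lam from vec E G lam)

variable (E G lam) in
/-- The reversal of `Cl(𝔤)`, as a continuous linear map. -/
def reverseCLM : Cl E G lam →L[ℂ] Cl E G lam := LinearMap.toContinuousLinearMap reverse

instance : IsTopologicalRing (Cl E G lam) where
  continuous_mul := by
    have : Continuous fun p : Cl E G lam × Cl E G lam => mulCLM E G lam p.1 p.2 := by fun_prop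
    exact this

end CliffordFacts

/-! ### Analytic local lifts of orthogonal maps, by reflections. -/

section LocalLift

open CliffordAlgebra Filter Topology

variable {E : Type*} [NormedAddCommGroup E] [NormedSpace ℂ E] [FiniteDimensional ℂ E]
  {G : Type*} [TopologicalSpace G] [ChartedSpace E G] [Group G] [LieGroup 𝓘(ℂ, E) ω G]
  {lam : Set.Ioi (0 : ℝ)}

variable (E G lam) in
/-- The form `B`, as a continuous bilinear map. -/
def formCLM : E →L[ℂ] E →L[ℂ] ℂ :=
  LinearMap.toContinuousLinearMap
    ((LinearMap.toContinuousLinearMap : (E →ₗ[ℂ] ℂ) ≃ₗ[ℂ] _).toLinearMap ∘ₗ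
      (show E →ₗ[ℂ] E →ₗ[ℂ] ℂ from formB E G lam))

variable (E G lam) in
/-- The map `v ↦ v - 2 B(v, n) n`, the reflection along `n` if `B(n, n) = 1`. -/
def reflCLM (n : E) : E →L[ℂ] E :=
  ContinuousLinearMap.id ℂ E - (2 : ℂ) • ((formCLM E G lam).flip n).smulRight n

theorem reflCLM_apply (n v : E) :
    reflCLM E G lam n v = v - (2 * formCLM E G lam v n) • n := by
  simp [reflCLM, smul_smul]

theorem contDiff_reflCLM : ContDiff ℂ ω (reflCLM E G lam) := by
  have h : ContDiff ℂ ω fun n : E => ((formCLM E G lam).flip n).smulRight n :=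
    ContDiff.smulRight (by fun_prop) contDiff_id
  exact contDiff_const.sub (h.const_smul (2 : ℂ))

theorem formCLM_comm (u v : E) : formCLM E G lam u v = formCLM E G lam v u :=
  formB_comm (G := G) u v

theorem formCLM_reflCLM {n : E} (hn : formCLM E G lam n n = 1) (u v : E) :
    formCLM E G lam (reflCLM E G lam n u) (reflCLM E G lam n v) = formCLM E G lam u v := by
  simp only [reflCLM_apply, map_sub, map_smul, sub_apply,
    smul_apply, smul_eq_mul, hn, formCLM_comm n v]
  ring

theorem reflCLM_reflCLM {n : E} (hn : formCLM E G lam n n = 1) (v : E) :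
    reflCLM E G lam n (reflCLM E G lam n v) = v := by
  simp only [reflCLM_apply, map_sub, map_smul, hn]
  module

/-- Conjugation by a unit vector is minus the reflection along it, so a product of two unit vectors
induces the composition of the two reflections. -/
theorem vecCLM_mul_vecCLM {n : E} (hn : formCLM E G lam n n = 1) (v : E) :
    vecCLM E G lam n * vecCLM E G lam v
      = vecCLM E G lam (-(reflCLM E G lam n v)) * vecCLM E G lam n := by
  have h := vec_mul_add E G lam n v
  have hs := vec_sq (lam := lam) (G := G) n hn
  have h2 : vecCLM E G lam n * vecCLM E G lam v + vecCLM E G lam v * vecCLM E G lam n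
    = algebraMap ℂ _ (-2 * formCLM E G lam v n) := by rw [formCLM_comm]; exact h
  have hs2 : vecCLM E G lam n * vecCLM E G lam n = -1 := hs
  rw [reflCLM_apply, neg_sub, map_sub, map_smul, sub_mul, smul_mul_assoc, hs2, smul_neg,
    ← Algebra.algebraMap_eq_smul_one, ← map_neg, eq_sub_iff_add_eq, h2]
  ring_nf

/-- A smooth family of orthogonal maps through the identity lifts locally to `Spin(𝔤)`. -/
theorem exists_local_lift {X : Type*} [NormedAddCommGroup X] [NormedSpace ℂ X] {n : ℕ}
    (e : Module.Basis (Fin n) ℂ E)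
    (he : ∀ i j, formCLM E G lam (e i) (e j) = if i = j then 1 else 0) (S : Set X) (x₀ : X)
    (k : ℕ) (hk : k ≤ n) (T : X → E →L[ℂ] E) (hT : ContDiffAt ℂ ω T x₀)
    (hT₀ : T x₀ = ContinuousLinearMap.id ℂ E)
    (hS : ∀ᶠ x in 𝓝 x₀, x ∈ S →
      (∀ u v, formCLM E G lam (T x u) (T x v) = formCLM E G lam u v) ∧
      ∀ i : Fin n, (i : ℕ) < n - k → T x (e i) = e i) :
    ∃ s : X → Cl E G lam, ContDiffAt ℂ ω s x₀ ∧ s x₀ = 1 ∧ ∀ᶠ x in 𝓝 x₀, x ∈ S →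
      s x ∈ spin E G lam ∧ ∀ v : E, s x * vecCLM E G lam v = vecCLM E G lam (T x v) * s x := by
  -- A Cartan-Dieudonné argument with parameters: `k` bounds the number of basis vectors not yet
  -- fixed. The reflection along the normalised sum `w` of `e a` and `T x (e a)` sends `T x (e a)`
  -- to `-e a`, and the reflection along `e a` sends this to `e a`. The sum is used because the
  -- difference vanishes at `x₀`.
  induction k generalizing T with
  | zero =>
    refine ⟨fun _ => 1, contDiffAt_const, rfl, ?_⟩
    filter_upwards [hS] with x hx hxS
    refine ⟨one_mem_spin, fun v => ?_⟩
    have h : T x = ContinuousLinearMap.id ℂ E := by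
      have : (T x).toLinearMap = LinearMap.id := e.ext fun i => (hx hxS).2 i (by omega)
      ext v
      exact congrArg (fun T : E →ₗ[ℂ] E => T v) this
    rw [h, one_mul, mul_one]
    rfl
  | succ k ih =>
    -- The vectors of index below `n - (k + 1)` are already fixed; `e a` is the next one.
    set a : Fin n := ⟨n - (k + 1), by omega⟩ with ha
    -- For `x ∈ S` near `x₀`, the sum `e a + T x (e a)` has square `4 q`, so it is normalised by `c
    -- = q^(-1/2) / 2`. The principal logarithm is analytic near `q x₀ = 1`.
    set q : X → ℂ := fun x => (1 + formCLM E G lam (e a) (T x (e a))) / 2 with hq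
    set c : X → ℂ := fun x => Complex.exp (-Complex.log (q x) / 2) / 2 with hc
    set w : X → E := fun x => c x • (e a + T x (e a)) with hw
    have hea : formCLM E G lam (e a) (e a) = 1 := by rw [he, if_pos rfl]
    have hTe : ContDiffAt ℂ ω (fun x => T x (e a)) x₀ := hT.clm_apply contDiffAt_const
    have hqd : ContDiffAt ℂ ω q x₀ :=
      (contDiffAt_const.add (contDiffAt_const.clm_apply hTe)).div_const 2
    have hq₀ : q x₀ = 1 := by
      simp only [hq, hT₀, ContinuousLinearMap.id_apply, hea]
      norm_num
    have hlog : ContDiffAt ℂ ω (fun x => Complex.log (q x)) x₀ :=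
      (Complex.contDiffAt_log (by rw [hq₀]; exact Complex.one_mem_slitPlane)).comp x₀ hqd
    have hcd : ContDiffAt ℂ ω c x₀ := ((hlog.neg.div_const 2).cexp).div_const 2
    have hc₀ : c x₀ = 1 / 2 := by simp [hc, hq₀]
    have hwd : ContDiffAt ℂ ω w x₀ := hcd.smul (contDiffAt_const.add hTe)
    have hw₀ : w x₀ = e a := by
      simp only [hw, hc₀, hT₀, ContinuousLinearMap.id_apply]
      module
    have hqne : ∀ᶠ x in 𝓝 x₀, q x ≠ 0 :=
      hqd.continuousAt.eventually_ne (by rw [hq₀]; exact one_ne_zero)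
    have hwu : ∀ᶠ x in 𝓝 x₀, x ∈ S → formCLM E G lam (w x) (w x) = 1 ∧
        c x ^ 2 * (2 * (1 + formCLM E G lam (e a) (T x (e a)))) = 1 := by
      filter_upwards [hS, hqne] with x hx hqx hxS
      have h1 : c x ^ 2 * (2 * (1 + formCLM E G lam (e a) (T x (e a)))) = 1 := by
        have h2 : Complex.exp (-Complex.log (q x) / 2) ^ 2 = (q x)⁻¹ := by
          rw [← Complex.exp_nat_mul, ← Complex.exp_log hqx, ← Complex.exp_neg, Complex.exp_log hqx]
          congr 1
          push_cast
          ring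
        have h3 : 2 * (1 + formCLM E G lam (e a) (T x (e a))) = 4 * q x := by
          simp only [hq]; ring
        rw [h3]
        simp only [hc, div_pow, h2]
        field_simp
        norm_num
      refine ⟨?_, h1⟩
      have h2 := ((hx hxS).1 (e a) (e a)).trans hea
      rw [← h1]
      simp only [hw, map_smul, map_add, smul_apply,
        add_apply, smul_eq_mul, h2, hea, formCLM_comm (T x (e a)) (e a)]
      ring
    set T' : X → E →L[ℂ] E := fun x =>
      (reflCLM E G lam (e a)) ∘L (reflCLM E G lam (w x)) ∘L T x with hT'
    have hT'd : ContDiffAt ℂ ω T' x₀ :=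
      contDiffAt_const.clm_comp
        ((contDiff_reflCLM.contDiffAt.comp x₀ hwd).clm_comp hT)
    obtain ⟨s, hsd, hs₀, hs⟩ := ih (by omega) T' hT'd
      (by
        ext v
        simp only [hT', hT₀, hw₀, ContinuousLinearMap.comp_apply, ContinuousLinearMap.id_apply]
        exact reflCLM_reflCLM hea v)
      (by
        filter_upwards [hS, hwu] with x hx hwx hxS
        obtain ⟨h1, h2⟩ := hx hxS
        obtain ⟨h3, h4⟩ := hwx hxS
        refine ⟨fun u v => ?_, fun i hi => ?_⟩
        · simp only [hT', ContinuousLinearMap.comp_apply]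
          rw [formCLM_reflCLM hea, formCLM_reflCLM h3, h1]
        · simp only [hT', ContinuousLinearMap.comp_apply]
          by_cases hia : i = a
          · rw [hia]
            have h5 : reflCLM E G lam (w x) (T x (e a)) = -e a := by
              have h6 := (h1 (e a) (e a)).trans hea
              rw [reflCLM_apply]
              simp only [hw, map_smul, map_add, smul_smul, smul_eq_mul, h6]
              have h7 : 2 * (c x * (formCLM E G lam (T x (e a)) (e a) + 1)) * c x = 1 := by
                rw [formCLM_comm (T x (e a)) (e a)]
                linear_combination h4
              rw [h7]
              module
            rw [h5, reflCLM_apply]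
            simp only [map_neg, neg_apply, hea]
            module
          · have hlt : (i : ℕ) < n - (k + 1) := by
              have : (i : ℕ) ≠ n - (k + 1) := fun h => hia (Fin.ext h)
              omega
            -- An already fixed `e i` is orthogonal to both `e a` and `T x (e a)`, hence to `w x`,
            -- so neither reflection moves it.
            have h5 : formCLM E G lam (e i) (e a) = 0 := by rw [he, if_neg hia]
            have h6 : formCLM E G lam (e i) (T x (e a)) = 0 := by
              rw [← h2 i hlt, h1, h5]
            have h7 : reflCLM E G lam (w x) (e i) = e i := by
              rw [reflCLM_apply]
              simp [hw, h5, h6]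
            rw [h2 i hlt, h7, reflCLM_apply, h5]
            simp)
    -- Since `T` is the reflection along `w` after that along `e a` after `T'`, it is lifted by `w ·
    -- (-e a) · s`. The sign makes the value at `x₀` equal to `1`, because `e a` squares to `-1`.
    refine ⟨fun x => mulCLM E G lam (mulCLM E G lam (vecCLM E G lam (w x))
      (vecCLM E G lam (-e a))) (s x), ?_, ?_, ?_⟩
    · have h1 : ContDiffAt ℂ ω (fun x => vecCLM E G lam (w x)) x₀ :=
        contDiffAt_const.clm_apply hwd
      exact (contDiffAt_const.clm_apply ((contDiffAt_const.clm_apply h1).clm_apply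
        contDiffAt_const)).clm_apply hsd
    · simp only [hs₀, hw₀]
      rw [mulCLM_apply, mulCLM_apply, mul_one, map_neg, mul_neg]
      have : vecCLM E G lam (e a) * vecCLM E G lam (e a) = -1 := vec_sq (G := G) (e a) hea
      rw [this, neg_neg]
    · filter_upwards [hs, hwu] with x hsx hwx hxS
      obtain ⟨h1, h2⟩ := hsx hxS
      obtain ⟨h3, h4⟩ := hwx hxS
      have hea' : formCLM E G lam (-e a) (-e a) = 1 := by simpa using hea
      refine ⟨mul_mem_spin (vec_mul_vec_mem_spin (G := G) h3 hea') h1, fun v => ?_⟩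
      simp only [mulCLM_apply]
      have hr : reflCLM E G lam (-e a) (T' x v) = reflCLM E G lam (w x) (T x v) := by
        have : reflCLM E G lam (-e a) (T' x v) = reflCLM E G lam (e a) (T' x v) := by
          simp [reflCLM_apply]
        rw [this]
        exact reflCLM_reflCLM hea _
      calc vecCLM E G lam (w x) * vecCLM E G lam (-e a) * s x * vecCLM E G lam v
          = vecCLM E G lam (w x) * (vecCLM E G lam (-e a) * vecCLM E G lam (T' x v)) * s x := by
            rw [mul_assoc _ (s x), h2]; simp only [mul_assoc]
        _ = -(vecCLM E G lam (w x) * vecCLM E G lam (reflCLM E G lam (w x) (T x v)))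
              * vecCLM E G lam (-e a) * s x := by
            rw [vecCLM_mul_vecCLM hea', hr, map_neg]; noncomm_ring
        _ = vecCLM E G lam (T x v) * (vecCLM E G lam (w x) * vecCLM E G lam (-e a) * s x) := by
            rw [vecCLM_mul_vecCLM h3, reflCLM_reflCLM h3, map_neg]; noncomm_ring

end LocalLift

/-! ### Connectedness arguments for open subgroups and signs. -/

section Topology

open Filter Topology

theorem subgroup_eq_top_of_mem_nhds_one {G : Type*} [TopologicalSpace G] [Group G]
    [IsTopologicalGroup G] [PreconnectedSpace G] (K : Subgroup G) (hK : (K : Set G) ∈ 𝓝 1) :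
    K = ⊤ := by
  have ho : IsOpen (K : Set G) := K.isOpen_of_mem_nhds hK
  have hc : IsClopen (K : Set G) := OpenSubgroup.isClopen ⟨K, ho⟩
  rw [← Subgroup.coe_eq_univ]
  exact hc.eq_univ ⟨1, K.one_mem⟩

/-- This is the rigidity principle for lifts, whose discrepancies are continuous signs: the sets
where `f` is `1` and `-1` are closed and, if `1 ≠ -1`, complementary. -/
theorem eq_one_of_eq_one_or_neg_one {X A : Type*} [TopologicalSpace X] [PreconnectedSpace X]
    [Ring A] [TopologicalSpace A] [T1Space A] {f : X → A} (hf : Continuous f)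
    (h : ∀ x, f x = 1 ∨ f x = -1) {x₀ : X} (h₀ : f x₀ = 1) (x : X) : f x = 1 := by
  by_cases h1 : (1 : A) = -1
  · rcases h x with hx | hx
    · exact hx
    · rw [hx, ← h1]
  have hc : IsClosed {x | f x = 1} := isClosed_singleton.preimage hf
  have ho : IsClosed {x | f x = 1}ᶜ := by
    have : {x | f x = 1}ᶜ = {x | f x = -1} := by
      ext y
      simp only [Set.mem_compl_iff, Set.mem_ofPred_eq]
      exact ⟨fun hy => (h y).resolve_left hy, fun hy hy' => h1 (hy'.symm.trans hy)⟩
    rw [this]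
    exact isClosed_singleton.preimage hf
  have := IsClopen.eq_univ ⟨hc, isClosed_compl_iff.1 ho⟩ ⟨x₀, h₀⟩
  exact this.symm.subset (Set.mem_univ x)

theorem eventually_eq_one_of_eq_one_or_neg_one {X A : Type*} [TopologicalSpace X]
    [Ring A] [TopologicalSpace A] [T1Space A] {f : X → A} {x₀ : X} (hf : ContinuousAt f x₀)
    (h : ∀ᶠ x in 𝓝 x₀, f x = 1 ∨ f x = -1) (h₀ : f x₀ = 1) : ∀ᶠ x in 𝓝 x₀, f x = 1 := by
  by_cases h1 : (1 : A) = -1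
  · filter_upwards [h] with x hx
    rcases hx with hx | hx
    · exact hx
    · rw [hx, ← h1]
  · filter_upwards [h, hf.eventually_ne (h₀.trans_ne h1)] with x hx hx'
    exact hx.resolve_right hx'

end Topology

/-! ### The covering group of `G` formed by the lifts of `Ad(g)`. -/

section Cover

open CliffordAlgebra Filter Topology

variable {E : Type*} [NormedAddCommGroup E] [NormedSpace ℂ E] [FiniteDimensional ℂ E]
  {G : Type*} [TopologicalSpace G] [ChartedSpace E G] [Group G] [LieGroup 𝓘(ℂ, E) ω G]
  {lam : Set.Ioi (0 : ℝ)}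

/-- The element `a` of `Cl(𝔤)` is even, of spinor norm one, and lifts `Ad(g)`. -/
structure LiftsAd (g : G) (a : Cl E G lam) : Prop where
  involute_eq : involute a = a
  mul_reverse : a * reverse a = 1
  reverse_mul : reverse a * a = 1
  mul_vec : ∀ v, a * vec E G lam v = vec E G lam (Ad E G g v) * a

namespace LiftsAd

theorem one : LiftsAd (1 : G) (1 : Cl E G lam) where
  involute_eq := map_one _
  mul_reverse := by rw [reverse.map_one, one_mul]
  reverse_mul := by rw [reverse.map_one, one_mul]
  mul_vec v := by rw [map_one, one_mul, mul_one]; rfl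

theorem mul {g h : G} {a b : Cl E G lam} (ha : LiftsAd g a) (hb : LiftsAd h b) :
    LiftsAd (g * h) (a * b) where
  involute_eq := by rw [map_mul, ha.involute_eq, hb.involute_eq]
  mul_reverse := by
    rw [reverse.map_mul, mul_assoc, ← mul_assoc b, hb.mul_reverse, one_mul, ha.mul_reverse]
  reverse_mul := by
    rw [reverse.map_mul, mul_assoc, ← mul_assoc _ a, ha.reverse_mul, one_mul, hb.reverse_mul]
  mul_vec v := by
    rw [mul_assoc, hb.mul_vec, ← mul_assoc, ha.mul_vec, mul_assoc, map_mul]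
    rfl

theorem reverse {g : G} {a : Cl E G lam} (ha : LiftsAd g a) :
    LiftsAd g⁻¹ (CliffordAlgebra.reverse a) where
  involute_eq := by rw [← reverse_involute, ha.involute_eq]
  mul_reverse := by rw [reverse_reverse, ha.reverse_mul]
  reverse_mul := by rw [reverse_reverse, ha.mul_reverse]
  mul_vec v := by
    have h := ha.mul_vec (Ad E G g⁻¹ v)
    rw [← Module.End.mul_apply, ← map_mul, mul_inv_cancel, map_one, Module.End.one_apply] at h
    calc CliffordAlgebra.reverse a * vec E G lam v
        = CliffordAlgebra.reverse a * (vec E G lam v * a) * CliffordAlgebra.reverse a := by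
          rw [mul_assoc, mul_assoc, ha.mul_reverse, mul_one]
      _ = _ := by rw [← h, ← mul_assoc, ha.reverse_mul, one_mul]

/-- Evenness and commutation with vectors force `a` to be a scalar `c`; reversal fixes scalars, so
the norm condition reads `c² = 1`. -/
theorem eq_one_or_neg_one [LieAlgebra.IsSemisimple ℂ (LieAlg E G)] {a : Cl E G lam}
    (ha : LiftsAd (1 : G) a) : a = 1 ∨ a = -1 := by
  obtain ⟨c, hc⟩ := exists_eq_algebraMap_of_even ha.involute_eq fun v => by
    rw [ha.mul_vec, map_one, Module.End.one_apply]
  have h := ha.mul_reverse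
  rw [hc, reverse.commutes, ← map_mul, ← map_one (algebraMap ℂ (Cl E G lam))] at h
  have h2 := FaithfulSMul.algebraMap_injective ℂ (Cl E G lam) h
  rcases mul_self_eq_one_iff.1 h2 with h3 | h3
  · exact Or.inl (by rw [hc, h3, map_one])
  · exact Or.inr (by rw [hc, h3, map_neg, map_one])

/-- The reversal of `b` is its inverse and lifts `Ad(g⁻¹)`, so the product lifts the identity. -/
theorem mul_reverse_eq [LieAlgebra.IsSemisimple ℂ (LieAlg E G)] {g : G} {a b : Cl E G lam}
    (ha : LiftsAd g a) (hb : LiftsAd g b) :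
    a * CliffordAlgebra.reverse b = 1 ∨ a * CliffordAlgebra.reverse b = -1 := by
  have := ha.mul hb.reverse
  rw [mul_inv_cancel] at this
  exact this.eq_one_or_neg_one

theorem eq_of_mul_reverse {g : G} {a b : Cl E G lam} (hb : LiftsAd g b)
    (h : a * CliffordAlgebra.reverse b = 1) : a = b := by
  rw [← mul_one a, ← hb.reverse_mul, ← mul_assoc, h, one_mul]

theorem of_mem_spin {g : G} {a : Cl E G lam} (ha : a ∈ spin E G lam)
    (h : ∀ v, a * vec E G lam v = vec E G lam (Ad E G g v) * a) : LiftsAd g a :=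
  ⟨involute_of_mem_spin ha, mul_reverse_of_mem_spin ha, by
    have := mul_reverse_of_mem_spin (reverse_mem_spin ha)
    rwa [reverse_reverse] at this, h⟩

end LiftsAd

theorem continuous_reverse : Continuous (reverse : Cl E G lam → Cl E G lam) :=
  (reverseCLM E G lam).continuous

/-- If two families of lifts agree at the identity, they agree near the identity. -/
theorem eventuallyEq_of_liftsAd [LieAlgebra.IsSemisimple ℂ (LieAlg E G)] {s t : G → Cl E G lam}
    (hs : ContinuousAt s 1) (ht : ContinuousAt t 1) (hs₁ : s 1 = 1) (ht₁ : t 1 = 1)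
    (hsl : ∀ᶠ g in 𝓝 1, LiftsAd g (s g)) (htl : ∀ᶠ g in 𝓝 1, LiftsAd g (t g)) :
    s =ᶠ[𝓝 1] t := by
  have h := eventually_eq_one_of_eq_one_or_neg_one (f := fun g => s g * reverse (t g))
    (hs.mul (continuous_reverse.continuousAt.comp ht))
    (by filter_upwards [hsl, htl] with g h1 h2 using h1.mul_reverse_eq h2)
    (by simp only [hs₁, ht₁, reverse.map_one, mul_one])
  filter_upwards [h, htl] with g h1 h2 using h2.eq_of_mul_reverse h1

-- Here `exists_local_lift` is applied to `Ad` in the chart, with `k` the full dimension, so that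
-- its condition on fixed basis vectors is vacuous.
variable (E G lam) in
theorem exists_smooth_local_lift [LieAlgebra.IsSemisimple ℂ (LieAlg E G)] :
    ∃ s : G → Cl E G lam, ContMDiffAt 𝓘(ℂ, E) 𝓘(ℂ, Cl E G lam) ω s 1 ∧ s 1 = 1 ∧
      ∀ᶠ g in 𝓝 1, s g ∈ spin E G lam ∧
        ∀ v, s g * vec E G lam v = vec E G lam (Ad E G g v) * s g := by
  obtain ⟨s, hs, hs₁, hsl⟩ := exists_local_lift (G := G) (lam := lam) (X := E)
    (show Module.Basis _ ℂ E from onb E G lam) (onb_spec E G lam) Set.univ (idChart E G 1)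
    (Module.finrank ℂ (LieAlg E G)) le_rfl (chartAd E G) (contDiffAt_chartAd E G)
    (chartAd_idChart_one E G)
    (Eventually.of_forall fun x _ => ⟨fun u v => formB_Ad E G lam _ u v, fun i hi => by omega⟩)
  refine ⟨s ∘ idChart E G, ?_, hs₁, ?_⟩
  · exact ContMDiffAt.comp (1 : G) hs.contMDiffAt (contMDiffAt_idChart E G)
  · have hc : ContinuousAt (idChart E G) 1 := (contMDiffAt_idChart E G).continuousAt
    filter_upwards [hc.eventually hsl, extChartAt_source_mem_nhds (I := 𝓘(ℂ, E)) (1 : G)]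
      with g hg hgs
    refine ⟨(hg trivial).1, fun v => ((hg trivial).2 v).trans ?_⟩
    have : idChartSymm E G (idChart E G g) = g := (extChartAt 𝓘(ℂ, E) (1 : G)).left_inv hgs
    rw [chartAd, this]
    rfl

variable (E G lam) in
/-- The group of the pairs `(g, a)` such that `a` lifts `Ad(g)`. -/
def adCover : Subgroup (G × (Cl E G lam)ˣ) where
  carrier := {p | LiftsAd p.1 (p.2 : Cl E G lam)}
  one_mem' := LiftsAd.one
  mul_mem' ha hb := ha.mul hb
  inv_mem' {p} hp := by
    have : ((p⁻¹).2 : Cl E G lam) = reverse (p.2 : Cl E G lam) :=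
      Units.inv_eq_of_mul_eq_one_right hp.mul_reverse
    change LiftsAd p.1⁻¹ ((p⁻¹).2 : Cl E G lam)
    rw [this]
    exact hp.reverse

variable (E G lam) in
/-- The projection of `adCover` to `G`. -/
def adCoverProj : adCover E G lam →* G := (MonoidHom.fst _ _).comp (adCover E G lam).subtype

theorem continuous_adCoverProj : Continuous (adCoverProj E G lam) :=
  continuous_fst.comp continuous_subtype_val

/-- The unit of `Cl(𝔤)` which is given by a lift of `Ad(g)`. -/
def LiftsAd.unit {g : G} {a : Cl E G lam} (ha : LiftsAd g a) : (Cl E G lam)ˣ :=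
  ⟨a, CliffordAlgebra.reverse a, ha.mul_reverse, ha.reverse_mul⟩

variable [LieAlgebra.IsSemisimple ℂ (LieAlg E G)]

/-- A morphism of topological groups is open as soon as it is open at the identity, and the local
lift provides a section `σ` continuous there. -/
theorem isOpenMap_adCoverProj : IsOpenMap (adCoverProj E G lam) := by
  have : IsTopologicalGroup G := topologicalGroup_of_lieGroup 𝓘(ℂ, E) ω
  classical
  obtain ⟨s, hs, hs₁, hsl⟩ := exists_smooth_local_lift E G lam
  have hl : ∀ᶠ g in 𝓝 (1 : G), LiftsAd g (s g) := by
    filter_upwards [hsl] with g hg using .of_mem_spin hg.1 hg.2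
  rw [IsTopologicalGroup.isOpenMap_iff_nhds_one]
  -- The default value `1` is harmless: only the germ of `σ` at the identity is used.
  let σ : G → adCover E G lam := fun g =>
    if h : LiftsAd g (s g) then ⟨(g, h.unit), h⟩ else 1
  have hσ₁ : σ 1 = 1 := by
    have h : LiftsAd (1 : G) (s 1) := by rw [hs₁]; exact .one
    simp only [σ, dif_pos h]
    refine Subtype.ext (Prod.ext rfl (Units.ext ?_))
    exact hs₁
  have hσ : ContinuousAt σ 1 := by
    rw [Topology.IsInducing.subtypeVal.continuousAt_iff]
    refine ContinuousAt.prodMk ?_ ?_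
    · refine continuousAt_id.congr ?_
      filter_upwards [hl] with g hg
      simp [σ, dif_pos hg]
    -- Continuity into the units also involves the inverse, which here is the linear map `reverse`.
    · rw [Units.isInducing_embedProduct.continuousAt_iff]
      refine ContinuousAt.prodMk ?_ ?_
      · refine hs.continuousAt.congr ?_
        filter_upwards [hl] with g hg
        simp [σ, dif_pos hg, LiftsAd.unit]
      · refine ContinuousAt.congr (f := fun g => MulOpposite.op (reverse (s g)))
          (MulOpposite.continuous_op.continuousAt.comp
            (continuous_reverse.continuousAt.comp hs.continuousAt)) ?_
        filter_upwards [hl] with g hg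
        simp [σ, dif_pos hg, LiftsAd.unit]
  rw [ContinuousAt, hσ₁] at hσ
  have h := Filter.map_mono (m := adCoverProj E G lam) hσ
  rw [Filter.map_map] at h
  refine le_trans (le_of_eq ?_) h
  have hid : adCoverProj E G lam ∘ σ =ᶠ[𝓝 1] id := by
    filter_upwards [hl] with g hg
    simp [σ, dif_pos hg, adCoverProj]
  rw [Filter.map_congr hid, Filter.map_id]

/-- Finiteness yields the discreteness of the kernel that makes the quotient map a covering. -/
theorem finite_ker_adCoverProj : ((adCoverProj E G lam).ker : Set (adCover E G lam)).Finite := by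
  have hinj : Function.Injective fun p : adCover E G lam => (p.1.1, (p.1.2 : Cl E G lam)) := by
    intro p q h
    exact Subtype.ext (Prod.ext (Prod.ext_iff.1 h).1 (Units.ext (Prod.ext_iff.1 h).2))
  refine Set.Finite.of_finite_image (f := fun p : adCover E G lam => (p.1.1, (p.1.2 : Cl E G lam)))
    (Set.Finite.subset (Set.toFinite {((1 : G), (1 : Cl E G lam)), (1, -1)}) ?_) hinj.injOn
  rintro _ ⟨⟨⟨g, a⟩, ha⟩, hg, rfl⟩
  obtain rfl : g = 1 := hg
  rcases LiftsAd.eq_one_or_neg_one ha with h | h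
  · exact Or.inl (Prod.ext rfl h)
  · exact Or.inr (Prod.ext rfl h)

variable [PreconnectedSpace G]

theorem adCoverProj_surjective : Function.Surjective (adCoverProj E G lam) := by
  have : IsTopologicalGroup G := topologicalGroup_of_lieGroup 𝓘(ℂ, E) ω
  rw [← MonoidHom.range_eq_top]
  refine subgroup_eq_top_of_mem_nhds_one _ ?_
  exact (isOpenMap_adCoverProj.isOpen_range).mem_nhds ⟨1, map_one _⟩

theorem isCoveringMap_adCoverProj [T2Space G] : IsCoveringMap (adCoverProj E G lam) := by
  have : IsTopologicalGroup G := topologicalGroup_of_lieGroup 𝓘(ℂ, E) ω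
  have hq : Topology.IsQuotientMap (adCoverProj E G lam) :=
    isOpenMap_adCoverProj.isQuotientMap continuous_adCoverProj adCoverProj_surjective
  exact (hq.isQuotientCoveringMap_of_isDiscrete_ker_monoidHom
    finite_ker_adCoverProj.isDiscrete).isCoveringMap

end Cover

/-! ### Uniqueness and existence of the lift of `Ad`. -/

section Lift

open CliffordAlgebra Filter Topology

variable {E : Type*} [NormedAddCommGroup E] [NormedSpace ℂ E] [FiniteDimensional ℂ E]
  {G : Type*} [TopologicalSpace G] [ChartedSpace E G] [Group G] [LieGroup 𝓘(ℂ, E) ω G]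
  {lam : Set.Ioi (0 : ℝ)}

theorem AdLift.map_one (L : AdLift E G lam) : L.toMonoidHom 1 = 1 := _root_.map_one _

theorem AdLift.liftsAd (L : AdLift E G lam) (g : G) : LiftsAd g (L.toMonoidHom g) :=
  .of_mem_spin (L.mem_spin g) fun v => by
    have h : L.toMonoidHom g * vec E G lam v * L.toMonoidHom g⁻¹ = vec E G lam (Ad E G g v) :=
      L.lift g v
    rw [← h, mul_assoc _ _ (L.toMonoidHom g), ← _root_.map_mul, inv_mul_cancel, L.map_one, mul_one]

theorem AdLift.map_inv (L : AdLift E G lam) (g : G) :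
    L.toMonoidHom g⁻¹ = reverse (L.toMonoidHom g) := by
  have h : L.toMonoidHom g⁻¹ * L.toMonoidHom g = 1 := by
    rw [← _root_.map_mul, inv_mul_cancel, L.map_one]
  rw [← mul_one (L.toMonoidHom g⁻¹), ← (L.liftsAd g).mul_reverse, ← mul_assoc, h, one_mul]

variable [LieAlgebra.IsSemisimple ℂ (LieAlg E G)]

theorem AdLift.eq [PreconnectedSpace G] (L L' : AdLift E G lam) : L' = L := by
  have h := eq_one_of_eq_one_or_neg_one
    (f := fun g => L'.toMonoidHom g * reverse (L.toMonoidHom g)) (x₀ := 1)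
    (L'.continuous.mul (continuous_reverse.comp L.continuous))
    (fun g => (L'.liftsAd g).mul_reverse_eq (L.liftsAd g))
    (by simp only [AdLift.map_one, reverse.map_one, mul_one])
  have h2 : L'.toMonoidHom = L.toMonoidHom :=
    MonoidHom.ext fun g => (L.liftsAd g).eq_of_mul_reverse (h g)
  cases L; cases L'
  congr

theorem exists_adLift [T2Space G] [SimplyConnectedSpace G] : Nonempty (AdLift E G lam) := by
  have : IsTopologicalGroup G := topologicalGroup_of_lieGroup 𝓘(ℂ, E) ω
  have : LocallyPathConnectedSpace G := ChartedSpace.locallyPathConnectedSpace E G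
  -- The identity of `G` is lifted through the covering, with base points at the identities; this
  -- gives a continuous section, not yet known to be a morphism.
  obtain ⟨F, ⟨hF₁, hF⟩, -⟩ :=
    (isCoveringMap_adCoverProj (E := E) (G := G) (lam := lam)).existsUnique_continuousMap_lifts
      (ContinuousMap.id G) 1 1 (map_one _)
  have hfst : ∀ g, (F g).1.1 = g := fun g => congrFun hF g
  set ℓ : G → Cl E G lam := fun g => ((F g).1.2 : Cl E G lam) with hℓ
  have hl : ∀ g, LiftsAd g (ℓ g) := fun g => by
    have := (F g).2
    change LiftsAd (F g).1.1 (ℓ g) at this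
    rwa [hfst] at this
  have hc : Continuous ℓ :=
    Units.continuous_val.comp (continuous_snd.comp (continuous_subtype_val.comp F.continuous))
  have hl₁ : ℓ 1 = 1 := by simp [hℓ, hF₁]
  have hmul : ∀ g h, ℓ (g * h) = ℓ g * ℓ h := by
    intro g h
    -- Both `ℓ (g h)` and `ℓ g · ℓ h` lift `Ad(g h)`; their ratio is a continuous sign on the
    -- connected space `G × G`.
    have h1 := eq_one_of_eq_one_or_neg_one
      (f := fun p : G × G => ℓ (p.1 * p.2) * reverse (ℓ p.1 * ℓ p.2)) (x₀ := (1, 1))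
      ((hc.comp continuous_mul).mul (continuous_reverse.comp
        ((hc.comp continuous_fst).mul (hc.comp continuous_snd))))
      (fun p => (hl _).mul_reverse_eq ((hl _).mul (hl _)))
      (by simp only [mul_one, hl₁, reverse.map_one])
    exact ((hl g).mul (hl h)).eq_of_mul_reverse (h1 (g, h))
  let L : G →* Cl E G lam := { toFun := ℓ, map_one' := hl₁, map_mul' := hmul }
  have hinv : ∀ g, ℓ g⁻¹ = reverse (ℓ g) := fun g => by
    have h : ℓ g⁻¹ * ℓ g = 1 := by rw [← hmul, inv_mul_cancel, hl₁]
    rw [← mul_one (ℓ g⁻¹), ← (hl g).mul_reverse, ← mul_assoc, h, one_mul]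
  obtain ⟨s, hs, hs₁, hsl⟩ := exists_smooth_local_lift E G lam
  have hev := eventuallyEq_of_liftsAd hc.continuousAt hs.continuousAt hl₁ hs₁
    (Eventually.of_forall hl) (hsl.mono fun g hg => .of_mem_spin hg.1 hg.2)
  -- The covering gives only even elements of norm one. That they are products of unit vectors holds
  -- near the identity, where `ℓ` agrees with `s`, and spreads because `K` is a subgroup.
  let K : Subgroup G :=
    { carrier := {g | ℓ g ∈ spin E G lam}
      one_mem' := by
        change ℓ 1 ∈ spin E G lam
        rw [hl₁]
        exact one_mem_spin
      mul_mem' := fun {g h} hg hh => by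
        change ℓ (g * h) ∈ spin E G lam
        rw [hmul]
        exact mul_mem_spin hg hh
      inv_mem' := fun {g} hg => by
        change ℓ g⁻¹ ∈ spin E G lam
        rw [hinv]
        exact reverse_mem_spin hg }
  have hK : K = ⊤ := by
    refine subgroup_eq_top_of_mem_nhds_one K ?_
    filter_upwards [hev, hsl] with g h1 h2
    change ℓ g ∈ spin E G lam
    rw [h1]
    exact h2.1
  refine ⟨⟨L, fun g => ?_, hc, fun g v => ?_⟩⟩
  · have : g ∈ K := hK ▸ Subgroup.mem_top g
    exact this
  · change ℓ g * vec E G lam v * ℓ g⁻¹ = _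
    rw [hinv, (hl g).mul_vec, mul_assoc, (hl g).mul_reverse, mul_one]

end Lift

/-! ### Commutators and symmetries of the bivector of `ad(u)`. -/

section Bivector

open CliffordAlgebra

variable {E : Type*} [NormedAddCommGroup E] [NormedSpace ℂ E] [FiniteDimensional ℂ E]
  {G : Type*} [TopologicalSpace G] [ChartedSpace E G] [Group G] [LieGroup 𝓘(ℂ, E) ω G]
  {lam : Set.Ioi (0 : ℝ)}

theorem formB_lie_left (u v w : LieAlg E G) :
    formB E G lam ⁅u, v⁆ w = -formB E G lam v ⁅u, w⁆ := by
  simp only [formB, LinearMap.smul_apply]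
  rw [← lie_skew, map_neg, LinearMap.neg_apply, LieModule.traceForm_apply_lie_apply, smul_neg]

theorem formB_lie_self (u v : LieAlg E G) : formB E G lam v ⁅u, v⁆ = 0 := by
  have h := formB_lie_left (lam := lam) u v v
  rw [formB_comm] at h
  exact self_eq_neg.1 h

variable [LieAlgebra.IsSemisimple ℂ (LieAlg E G)]

theorem sum_formB_smul_onb (x : LieAlg E G) :
    ∑ j, formB E G lam (onb E G lam j) x • onb E G lam j = x := by
  have h : ∀ i, formB E G lam (onb E G lam i) x = (onb E G lam).repr x i := by
    intro i
    conv_lhs => rw [← (onb E G lam).sum_repr x]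
    simp only [map_sum, map_smul, onb_spec E G lam i]
    simp
  simp only [h, (onb E G lam).sum_repr]

theorem involute_bivector (u : Module.End ℂ (LieAlg E G)) :
    involute (bivector E G lam u) = bivector E G lam u := by
  simp only [bivector, map_smul, map_sum, map_mul, involute_ι, neg_mul_neg]

/-- By invariance of `B`, each `e_j` is orthogonal to `[u, e_j]`; the two anticommute, so reversal
changes the sign of every term. -/
theorem reverse_bivector_ad (u : LieAlg E G) :
    reverse (bivector E G lam (LieAlgebra.ad ℂ _ u)) = -bivector E G lam (LieAlgebra.ad ℂ _ u) := by
  simp only [bivector, map_smul, map_sum, reverse.map_mul, reverse_ι, LieAlgebra.ad_apply]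
  rw [← smul_neg, ← Finset.sum_neg_distrib]
  congr 1
  refine Finset.sum_congr rfl fun j _ => ?_
  have h := vec_mul_add E G lam (onb E G lam j) ⁅u, onb E G lam j⁆
  rw [formB_lie_self, mul_zero, map_zero] at h
  exact eq_neg_of_add_eq_zero_right h

theorem bivector_ad_mul_vec (u v : LieAlg E G) :
    bivector E G lam (LieAlgebra.ad ℂ _ u) * vec E G lam v
      = vec E G lam v * bivector E G lam (LieAlgebra.ad ℂ _ u) + (2 : ℂ) • vec E G lam ⁅u, v⁆ := by
  -- Move `v` leftwards past `w`, then past `a`. In the sum over `a = e_j`, `w = [u, e_j]`, both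
  -- correction terms contribute `[u, v]`, the second by skewness of `ad(u)`.
  have key : ∀ a w : LieAlg E G, vec E G lam a * vec E G lam w * vec E G lam v
      = vec E G lam v * (vec E G lam a * vec E G lam w)
        + (2 : ℂ) • vec E G lam (formB E G lam a v • w - formB E G lam w v • a) := by
    intro a w
    have h1 := eq_sub_of_add_eq (vec_mul_add E G lam w v)
    have h2 := eq_sub_of_add_eq (vec_mul_add E G lam a v)
    calc vec E G lam a * vec E G lam w * vec E G lam v
        = vec E G lam a * (vec E G lam w * vec E G lam v) := mul_assoc _ _ _
      _ = vec E G lam a * algebraMap ℂ _ (-2 * formB E G lam w v)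
            - (vec E G lam a * vec E G lam v) * vec E G lam w := by rw [h1]; noncomm_ring
      _ = vec E G lam a * algebraMap ℂ _ (-2 * formB E G lam w v)
            - algebraMap ℂ _ (-2 * formB E G lam a v) * vec E G lam w
            + vec E G lam v * (vec E G lam a * vec E G lam w) := by rw [h2]; noncomm_ring
      _ = _ := by
        rw [← Algebra.commutes, ← Algebra.smul_def, ← Algebra.smul_def, map_sub, map_smul, map_smul]
        module
  simp only [bivector, LieAlgebra.ad_apply, smul_mul_assoc, mul_smul_comm, Finset.sum_mul,
    Finset.mul_sum, key, Finset.sum_add_distrib, smul_add]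
  congr 1
  rw [← Finset.smul_sum, ← map_sum, Finset.sum_sub_distrib]
  have h1 : ∑ j, formB E G lam (onb E G lam j) v • ⁅u, onb E G lam j⁆ = ⁅u, v⁆ := by
    conv_rhs => rw [← sum_formB_smul_onb (lam := lam) v]
    simp only [lie_sum, lie_smul]
  have h2 : ∑ j, formB E G lam ⁅u, onb E G lam j⁆ v • onb E G lam j = -⁅u, v⁆ := by
    conv_rhs => rw [← sum_formB_smul_onb (lam := lam) ⁅u, v⁆]
    simp only [formB_lie_left, neg_smul, Finset.sum_neg_distrib]
  rw [h1, h2, map_sub, map_neg]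
  module

end Bivector

/-! ### Analyticity and differential of the lift. -/

section Smooth

open CliffordAlgebra Filter Topology

variable {E : Type*} [NormedAddCommGroup E] [NormedSpace ℂ E]
  {G : Type*} [TopologicalSpace G] [ChartedSpace E G]

theorem contMDiff_real {F : Type*} [NormedAddCommGroup F] [NormedSpace ℂ F] {n : WithTop ℕ∞}
    {f : G → F} (h : ContMDiff 𝓘(ℂ, E) 𝓘(ℂ, F) n f) : ContMDiff 𝓘(ℝ, E) 𝓘(ℝ, F) n f :=
  fun x => ⟨(h x).1, ContDiffWithinAt.restrict_scalars ℝ (h x).2⟩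

theorem hasMFDerivAt_real_of_complex {F : Type*} [NormedAddCommGroup F] [NormedSpace ℂ F]
    {f : G → F} {x : G} {f' : E →L[ℂ] F} (h : HasMFDerivAt 𝓘(ℂ, E) 𝓘(ℂ, F) f x f') :
    HasMFDerivAt 𝓘(ℝ, E) 𝓘(ℝ, F) f x (f'.restrictScalars ℝ) :=
  ⟨h.1, HasFDerivWithinAt.restrictScalars ℝ h.2⟩

variable [FiniteDimensional ℂ E] [Group G] [LieGroup 𝓘(ℂ, E) ω G] {lam : Set.Ioi (0 : ℝ)}
  [LieAlgebra.IsSemisimple ℂ (LieAlg E G)]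

/-- Continuity suffices: by rigidity the lift coincides near the identity with the analytic local
one. -/
theorem AdLift.contMDiffAt_one (L : AdLift E G lam) :
    ContMDiffAt 𝓘(ℂ, E) 𝓘(ℂ, Cl E G lam) ω L.toMonoidHom 1 := by
  obtain ⟨s, hs, hs₁, hsl⟩ := exists_smooth_local_lift E G lam
  refine hs.congr_of_eventuallyEq ?_
  exact eventuallyEq_of_liftsAd L.continuous.continuousAt hs.continuousAt L.map_one hs₁
    (Eventually.of_forall L.liftsAd) (hsl.mono fun g hg => .of_mem_spin hg.1 hg.2)

theorem AdLift.contMDiff (L : AdLift E G lam) :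
    ContMDiff 𝓘(ℂ, E) 𝓘(ℂ, Cl E G lam) ω L.toMonoidHom := by
  intro g
  have h1 : ContMDiffAt 𝓘(ℂ, E) 𝓘(ℂ, Cl E G lam) ω (fun x => L.toMonoidHom (g⁻¹ * x)) g :=
    ContMDiffAt.comp_of_eq (g := L.toMonoidHom) (f := fun x => g⁻¹ * x) L.contMDiffAt_one
      contMDiff_mul_left.contMDiffAt (by simp)
  have h2 : ContMDiffAt 𝓘(ℂ, E) 𝓘(ℂ, Cl E G lam) ω
      (fun x => mulCLM E G lam (L.toMonoidHom g) (L.toMonoidHom (g⁻¹ * x))) g :=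
    ContMDiffAt.comp g (g := mulCLM E G lam (L.toMonoidHom g))
      (mulCLM E G lam (L.toMonoidHom g)).contMDiff.contMDiffAt h1
  refine h2.congr_of_eventuallyEq (Eventually.of_forall fun x => ?_)
  change L.toMonoidHom x = L.toMonoidHom g * L.toMonoidHom (g⁻¹ * x)
  rw [lift_mul, mul_inv_cancel_left]

/-- The differential at the identity of a lift of the adjoint representation. -/
def AdLift.deriv (L : AdLift E G lam) : E →L[ℂ] Cl E G lam :=
  mfderiv 𝓘(ℂ, E) 𝓘(ℂ, Cl E G lam) L.toMonoidHom 1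

theorem AdLift.hasMFDerivAt (L : AdLift E G lam) :
    HasMFDerivAt 𝓘(ℂ, E) 𝓘(ℂ, Cl E G lam) L.toMonoidHom 1 L.deriv :=
  (L.contMDiffAt_one.mdifferentiableAt (by simp)).hasMFDerivAt

theorem AdLift.hasFDerivAt (L : AdLift E G lam) :
    HasFDerivAt (fun x => L.toMonoidHom (idChartSymm E G x)) L.deriv (idChart E G 1) := by
  have h := HasMFDerivAt.comp (I'' := 𝓘(ℂ, Cl E G lam)) (x := idChart E G 1) (g := L.toMonoidHom)
    (g' := L.deriv) (by rw [idChartSymm_one]; exact L.hasMFDerivAt) (hasMFDerivAt_idChartSymm E G)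
  exact hasMFDerivAt_iff_hasFDerivAt.1 h

theorem AdLift.involute_deriv (L : AdLift E G lam) (u : LieAlg E G) :
    involute (L.deriv u) = L.deriv u := by
  let T : Cl E G lam →L[ℂ] Cl E G lam :=
    LinearMap.toContinuousLinearMap (involute : Cl E G lam →ₐ[ℂ] Cl E G lam).toLinearMap
  have h := T.hasFDerivAt.comp (idChart E G 1) L.hasFDerivAt
  have h2 := L.hasFDerivAt.congr_of_eventuallyEq
    (f₁ := T ∘ fun x => L.toMonoidHom (idChartSymm E G x))
    (Eventually.of_forall fun x => (L.liftsAd _).involute_eq)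
  exact congrArg (fun T : E →L[ℂ] Cl E G lam => T u) (h.unique h2)

/-- Differentiate the norm condition `a · reverse a = 1` at the identity. -/
theorem AdLift.reverse_deriv (L : AdLift E G lam) (u : LieAlg E G) :
    reverse (L.deriv u) = -L.deriv u := by
  have h1 := (reverseCLM E G lam).hasFDerivAt.comp (idChart E G 1) L.hasFDerivAt
  have h2 := ((mulCLM E G lam).hasFDerivAt.comp (idChart E G 1) L.hasFDerivAt).clm_apply h1
  have h3 := (hasFDerivAt_const (𝕜 := ℂ) (1 : Cl E G lam) (idChart E G 1)).congr_of_eventuallyEq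
    (Eventually.of_forall fun x => (L.liftsAd (idChartSymm E G x)).mul_reverse)
  have h4 := congrArg (fun T : E →L[ℂ] Cl E G lam => T u) (h2.unique h3)
  simp [AdLift.map_one] at h4
  have h5 : 1 * reverse (L.deriv u) + L.deriv u * reverse 1 = 0 := h4
  rw [reverse.map_one, one_mul, mul_one] at h5
  exact eq_neg_of_add_eq_zero_left h5

/-- Differentiate `L(x) v = Ad(x)(v) L(x)` at the identity, where the derivative of `Ad` is the
bracket. -/
theorem AdLift.deriv_mul_vec (L : AdLift E G lam) (u v : LieAlg E G) :
    L.deriv u * vec E G lam v = vec E G lam v * L.deriv u + vec E G lam ⁅u, v⁆ := by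
  have hA := (((contDiffAt_chartAd E G).differentiableAt (by simp)).hasFDerivAt).clm_apply
    (hasFDerivAt_const (show E from v) _)
  have h1 := ((mulCLM E G lam).hasFDerivAt.comp (idChart E G 1)
    ((vecCLM E G lam).hasFDerivAt.comp (idChart E G 1) hA)).clm_apply L.hasFDerivAt
  have h2 := ((mulCLM E G lam).hasFDerivAt.comp (idChart E G 1) L.hasFDerivAt).clm_apply
    (hasFDerivAt_const (vec E G lam v) _)
  have h3 := h1.congr_of_eventuallyEq
    (Eventually.of_forall fun x => (L.liftsAd (idChartSymm E G x)).mul_vec v)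
  have h4 := congrArg (fun T : E →L[ℂ] Cl E G lam => T u) (h2.unique h3)
  simp [AdLift.map_one] at h4
  have h5 : L.deriv u * vec E G lam v = vecCLM E G lam (chartAd E G (idChart E G 1) v) * L.deriv u
    + vecCLM E G lam (fderiv ℂ (chartAd E G) (idChart E G 1) u v) * 1 := h4
  rw [chartAd_idChart_one, mul_one, ← bracket_eq_fderiv_chartAd] at h5
  exact h5

/-- The differential of the lift of the adjoint representation. -/
theorem AdLift.deriv_eq (L : AdLift E G lam) (u : LieAlg E G) :
    L.deriv u = (1 / 2 : ℂ) • bivector E G lam (LieAlgebra.ad ℂ _ u) := by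
  set b := bivector E G lam (LieAlgebra.ad ℂ _ u) with hb
  -- The commutator of the bivector with `v` is twice `[u, v]`, which is the origin of the factor `1
  -- / 2`.
  obtain ⟨c, hc⟩ := exists_eq_algebraMap_of_even (x := L.deriv u - (1 / 2 : ℂ) • b)
    (by rw [map_sub, map_smul, L.involute_deriv, hb, involute_bivector])
    (fun v => by
      rw [sub_mul, mul_sub, L.deriv_mul_vec, smul_mul_assoc, hb, bivector_ad_mul_vec,
        mul_smul_comm]
      module)
  -- Reversal fixes the scalar `c` but negates the difference, so the difference equals its own
  -- opposite.
  have h1 := congrArg reverse hc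
  rw [map_sub, map_smul, L.reverse_deriv, hb, reverse_bivector_ad, ← hb, reverse.commutes] at h1
  have h2 : (2 : ℂ) • (L.deriv u - (1 / 2 : ℂ) • b) = 0 := by
    rw [two_smul]
    nth_rewrite 2 [hc]
    rw [← h1]
    module
  exact sub_eq_zero.1 ((smul_eq_zero.1 h2).resolve_left two_ne_zero)

end Smooth

/-! ### The canonical section and its covariant derivative. -/

section Section

open CliffordAlgebra

variable {E : Type*} [NormedAddCommGroup E] [NormedSpace ℂ E] [FiniteDimensional ℂ E]
  {G : Type*} [TopologicalSpace G] [ChartedSpace E G] [Group G] [LieGroup 𝓘(ℂ, E) ω G]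
  {lam : Set.Ioi (0 : ℝ)} (L : AdLift E G lam) (H : Subgroup G)

/-- The section `g H ↦ [g, L(g⁻¹)]` of the spinor bundle. -/
def canonicalSection : G ⧸ H → SpinorBundle L H :=
  Quotient.lift (fun g => spinorMk L H g (L.toMonoidHom g⁻¹)) (by
    intro a b hab
    have hab' : a⁻¹ * b ∈ H := QuotientGroup.leftRel_apply.1 hab
    refine Quotient.sound ⟨⟨a⁻¹ * b, hab'⟩, Prod.ext (by simp) ?_⟩
    change L.toMonoidHom b⁻¹ = L.toMonoidHom ((a⁻¹ * b)⁻¹ : G) * L.toMonoidHom a⁻¹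
    rw [lift_mul]
    simp)

variable [LieAlgebra.IsSemisimple ℂ (LieAlg E G)]

theorem isSmoothSection_canonicalSection : IsSmoothSection L (canonicalSection L H) := by
  refine ⟨fun g => L.toMonoidHom g⁻¹, ?_, fun g => rfl⟩
  have h1 : ContMDiff 𝓘(ℂ, E) 𝓘(ℂ, Cl E G lam) ω fun g => L.toMonoidHom g⁻¹ :=
    L.contMDiff.comp (contMDiff_inv 𝓘(ℂ, E) ω)
  exact (contMDiff_real h1).of_le le_top

theorem rhoStar_eq (A : lieH E H) (v : Cl E G lam) :
    rhoStar L A v = L.deriv (A : LieAlg E G) * v := by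
  have h := (hasMFDerivAt_real_of_complex L.hasMFDerivAt).mfderiv
  unfold rhoStar
  congr 1
  exact congrArg (fun T : E →L[ℝ] Cl E G lam => T (A : LieAlg E G)) h

/-- The derivative of `t ↦ L(γ(t)⁻¹)` along a curve `γ` in `G`. -/
theorem AdLift.hasDerivAt_inv {γ : ℝ → G} {ξ : TangentSpace 𝓘(ℂ, E) (γ 0)}
    (h : HasVelocityAt E γ 0 ξ) :
    HasDerivAt (fun t => L.toMonoidHom (γ t)⁻¹)
      (-(L.deriv (maurerCartan E (γ 0) ξ) * L.toMonoidHom (γ 0)⁻¹)) 0 := by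
  have h1 := HasMFDerivAt.comp (I'' := 𝓘(ℝ, E)) (x := (0 : ℝ))
    (hasMFDerivAt_real E (mdiff_mul_left E (γ 0)⁻¹ (γ 0)).hasMFDerivAt) h
  have e1 : (γ 0)⁻¹ * γ 0 = 1 := by simp
  have h2 := HasMFDerivAt.comp (I'' := 𝓘(ℝ, Cl E G lam)) (x := (0 : ℝ)) (g := L.toMonoidHom)
    (g' := L.deriv.restrictScalars ℝ)
    (by
      rw [Function.comp_apply, e1]
      exact hasMFDerivAt_real_of_complex L.hasMFDerivAt) h1
  have h3 := hasMFDerivAt_iff_hasFDerivAt.1 h2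
  let T : Cl E G lam →L[ℂ] Cl E G lam :=
    (mulCLM E G lam).flip (L.toMonoidHom (γ 0)⁻¹) ∘L reverseCLM E G lam
  have h4 := ((T.restrictScalars ℝ).hasFDerivAt.comp (0 : ℝ) h3).hasDerivAt
  -- Translating by `(γ 0)⁻¹` brings in the Maurer-Cartan form and only the differential of `L` at
  -- the identity; the linear map `reverse` takes the place of inversion.
  have e2 : (fun t => L.toMonoidHom (γ t)⁻¹)
      = T ∘ (L.toMonoidHom ∘ (fun x => (γ 0)⁻¹ * x) ∘ γ) := by
    ext t
    change L.toMonoidHom (γ t)⁻¹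
      = reverse (L.toMonoidHom ((γ 0)⁻¹ * γ t)) * L.toMonoidHom (γ 0)⁻¹
    rw [← L.map_inv, lift_mul]
    simp
  rw [e2]
  refine HasDerivAt.congr_deriv h4 ?_
  have e3 : ((1 : ℝ →L[ℝ] ℝ).smulRight (show E from ξ)) 1 = ξ := by
    rw [ContinuousLinearMap.smulRight_apply]
    exact one_smul ℝ (show E from ξ)
  change reverse (L.deriv ((mfderiv 𝓘(ℂ, E) 𝓘(ℂ, E) (fun x : G => (γ 0)⁻¹ * x) (γ 0) : E →L[ℂ] E)
    (((1 : ℝ →L[ℝ] ℝ).smulRight (show E from ξ)) 1))) * L.toMonoidHom (γ 0)⁻¹ = _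
  rw [e3, ← neg_mul, ← L.reverse_deriv]
  rfl

variable {H} in
theorem hasCovDeriv_canonicalSection (hH : IsCompactRealForm E H) (X : TGH E H) :
    HasCovDeriv L hH (canonicalSection L H) X
      ((-(1 / 2) : ℂ) • cliffordMul L (adMap L X) (canonicalSection L H X.proj)) := by
  rintro γ ξ hγ rfl
  refine ⟨fun t => L.toMonoidHom (γ t)⁻¹, _, fun t => rfl, L.hasDerivAt_inv hγ, ?_⟩
  set m : lieM E H := (lieM E H).projectionOnto (lieH E H) hH.isCompl.symm
    (maurerCartan E (γ 0) ξ) with hm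
  -- The `𝔥`-component of the derivative cancels against the connection term; only the
  -- `𝔪`-component, which represents `X` in the frame `γ 0`, remains.
  have hsum : maurerCartan E (γ 0) ξ = (connForm hH (γ 0) ξ : LieAlg E G) + (m : LieAlg E G) :=
    (Submodule.projection_add_projection_eq_self hH.isCompl _).symm
  have h1 : (-(1 / 2) : ℂ) • cliffordMul L (adMap L (dproj hH (γ 0) ξ))
      (canonicalSection L H (dproj hH (γ 0) ξ).proj)
      = spinorMk L H (γ 0) ((-(1 / 2) : ℂ) • (bivector E G lam (LieAlgebra.ad ℂ _ (m : LieAlg E G))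
        * L.toMonoidHom (γ 0)⁻¹)) :=
    congrArg (fun z => (-(1 / 2) : ℂ) • z) (cliffordMul_mk L (γ 0) _ _)
  rw [h1, rhoStar_eq, hsum]
  congr 1
  have h2 : L.deriv ((connForm hH (γ 0) ξ : LieAlg E G) + (m : LieAlg E G))
      = L.deriv (connForm hH (γ 0) ξ : LieAlg E G) + L.deriv (m : LieAlg E G) := map_add L.deriv _ _
  rw [h2, L.deriv_eq m, add_mul, smul_mul_assoc]
  module

end Section

end SymSpin

end

theorem mainTheorem5 {E : Type*} [NormedAddCommGroup E] [NormedSpace ℂ E] [FiniteDimensional ℂ E]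
    {G : Type*} [TopologicalSpace G] [ChartedSpace E G] [Group G] [LieGroup 𝓘(ℂ, E) ω G]
    [T2Space G] [SimplyConnectedSpace G] [LieAlgebra.IsSemisimple ℂ (SymSpin.LieAlg E G)]
    (H : Subgroup G) (hH : SymSpin.IsCompactRealForm E H) (hconn : IsConnected (H : Set G))
    (lam : Set.Ioi (0 : ℝ)) :
    ∃ L : SymSpin.AdLift E G lam, (∀ L' : SymSpin.AdLift E G lam, L' = L) ∧
      ∃ φ : G ⧸ H → SymSpin.SpinorBundle L H,
        (∀ g : G, φ (g : G ⧸ H) = SymSpin.spinorMk L H g (L.toMonoidHom g⁻¹)) ∧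
        (∀ x : G ⧸ H, φ x ∈ SymSpin.unitSpinors L H ∧ (φ x).proj = x) ∧
        SymSpin.IsSmoothSection L φ ∧
        ∀ X : SymSpin.TGH E H,
          SymSpin.HasCovDeriv L hH φ X
            ((-(1 / 2) : ℂ) • SymSpin.cliffordMul L (SymSpin.adMap L X) (φ X.proj)) := by
  obtain ⟨L⟩ := SymSpin.exists_adLift (E := E) (G := G) (lam := lam)
  refine ⟨L, fun L' => L.eq L', SymSpin.canonicalSection L H, fun g => rfl, fun x => ?_,
    SymSpin.isSmoothSection_canonicalSection L H,
    SymSpin.hasCovDeriv_canonicalSection L hH⟩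
  obtain ⟨g, rfl⟩ := QuotientGroup.mk_surjective x
  exact ⟨⟨g, g⁻¹, rfl⟩, rfl⟩
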